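/- Let $\Omega\subseteq\mathbf R^d$ be open and connected with $0\in\Omega$, and let $C=(c_{kl})_{k,l=1}^d$ be a matrix of real functions on $\Omega$ with $c_{kl}=c_{lk}\in W^{1,\infty}_{\rm loc}(\overline\Omega)$, the space of restrictions to $\Omega$ of functions in $W^{1,\infty}_{\rm loc}(\mathbf R^d)$ (functions in such spaces being identified with their continuous representatives), and $C(x)>0$ (positive definite) for all $x\in\Omega$. All functions are real-valued and derivatives are weak derivatives on $\Omega$. Put $$\Gamma(\varphi)=\sum_{k,l=1}^d c_{kl}\,(\partial_k\varphi)(\partial_l\varphi)\qquad(\varphi\in W^{1,2}_{\rm loc}(\Omega)),$$ $$d(x;y)=\sup\{\psi(x)-\psi(y):\psi\in W^{1,\infty}_{\rm loc}(\Omega),\ \Gamma(\psi)\le 1 \text{ a.e.}\},\qquad B(r)=\{x\in\Omega: d(x;0)<r\}.$$ Let $h(\varphi)=\sum_{k,l}(\partial_k\varphi,c_{kl}\,\partial_l\varphi)$ for $\varphi\in C_c^\infty(\Omega)$, where $(\cdot,\cdot)$ is the scalar product of $L_2(\Omega)$, and let $h_D$ be the closure of the form $h$ in $L_2(\Omega)$;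 so $D(h_D)$ consists of those $\varphi\in L_2(\Omega)$ for which there are $\chi_n\in C_c^\infty(\Omega)$ with $\|\chi_n-\varphi\|_2\to0$ and $h(\chi_n-\chi_m)\to0$ as $n,m\to\infty$. Let $$D(h_N)=\{\varphi\in W^{1,2}_{\rm loc}(\Omega):\Gamma(\varphi)+\varphi^2\in L_1(\Omega)\},\qquad \|\varphi\|_{D(h_N)}^2=\int_\Omega\Gamma(\varphi)+\|\varphi\|_2^2 .$$ One has $D(h_D)\subseteq D(h_N)$. For $A\subseteq\overline\Omega$, condition $\mathcal C_A$ says that there exist $\eta_1,\eta_2,\ldots\in D(h_D)$ such that $$\lim_{n\to\infty}\|1_A(1_\Omega-\eta_n)\varphi\|_2=0\ \text{ for each } \varphi\in L_2(\Omega)\qquad\text{and}\qquad \lim_{n\to\infty}\|1_A\Gamma(\eta_n)\|_1=0 ,$$ and the capacity of $A$ is $$\mathrm{cap}(A)=\inf\{\|\psi\|_{D(h_N)}^2:\psi\in D(h_N),\ 0\le\psi\le1,\ \psi=1 \text{ a.e. on } U\cap\Omega\text{ for some open } U\subseteq\mathbf R^d \text{ with } U\supseteq A\},$$ with $\mathrm{cap}(A)=\infty$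 if there is no such $\psi$. Assume that the balls $B(r)$ are bounded subsets of $\mathbf R^d$ for all $r>0$. Then the following conditions are equivalent: 1. $\mathcal C_A$ is satisfied for each bounded subset $A$ of $\overline\Omega$; 2. $\mathrm{cap}(\partial\Omega)=0$. -/

import Mathlib

open MeasureTheory Filter Topology Set
open scoped ContDiff ENNReal

noncomputable section

namespace DiffusionCapacity

/-- Euclidean space `ℝᵈ`. -/
abbrev Rd (d : ℕ) : Type := EuclideanSpace ℝ (Fin d)

variable {d : ℕ}

/-- The space `C_c^∞(Ω)`, as smooth functions on `ℝᵈ` with compact support contained in `Ω`. -/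
def IsTestFunction (Ω : Set (Rd d)) (χ : Rd d → ℝ) : Prop :=
  ContDiff ℝ ∞ χ ∧ HasCompactSupport χ ∧ tsupport χ ⊆ Ω

/-- The classical partial derivative `∂_k χ`. -/
def partialDeriv (k : Fin d) (χ : Rd d → ℝ) (x : Rd d) : ℝ :=
  fderiv ℝ χ x (EuclideanSpace.single k 1)

/-- `g` is a weak (distributional) `k`-th partial derivative of `f` on the open set `Ω`. -/
def HasWeakPartial (Ω : Set (Rd d)) (k : Fin d) (f g : Rd d → ℝ) : Prop :=
  LocallyIntegrableOn f Ω ∧ LocallyIntegrableOn g Ω ∧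
    ∀ χ : Rd d → ℝ, IsTestFunction Ω χ →
      ∫ x in Ω, f x * partialDeriv k χ x = -∫ x in Ω, g x * χ x

open Classical in
/-- The weak partial derivative `∂_k f` on `Ω` (unique up to null sets where it exists; the value
is `0` if there is none). -/
def weakPartial (Ω : Set (Rd d)) (k : Fin d) (f : Rd d → ℝ) : Rd d → ℝ :=
  if h : ∃ g, HasWeakPartial Ω k f g then h.choose else 0

/-- If a weak derivative exists then `weakPartial` is one. -/
theorem HasWeakPartial.weakPartial_spec {Ω : Set (Rd d)} {k : Fin d} {f g : Rd d → ℝ}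
    (h : HasWeakPartial Ω k f g) : HasWeakPartial Ω k f (weakPartial Ω k f) := by
  have h' : ∃ g, HasWeakPartial Ω k f g := ⟨g, h⟩
  rw [weakPartial, dif_pos h']
  exact h'.choose_spec

/-- `f ∈ L_{p,loc}(Ω)`. -/
def MemLpLoc (p : ℝ≥0∞) (Ω : Set (Rd d)) (f : Rd d → ℝ) : Prop :=
  ∀ K : Set (Rd d), IsCompact K → K ⊆ Ω → MemLp f p (volume.restrict K)

/-- `f ∈ W^{1,p}_loc(Ω)`. -/
def MemW1pLoc (p : ℝ≥0∞) (Ω : Set (Rd d)) (f : Rd d → ℝ) : Prop :=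
  MemLpLoc p Ω f ∧ ∀ k : Fin d, ∃ g : Rd d → ℝ, HasWeakPartial Ω k f g ∧ MemLpLoc p Ω g

/-- `f ∈ W^{1,∞}_loc(Ω)`.  Every class in this space has a unique continuous representative, with
which it is identified, so that pointwise values on `Ω` make sense. -/
def MemW1InftyLoc (Ω : Set (Rd d)) (f : Rd d → ℝ) : Prop :=
  ContinuousOn f Ω ∧ MemW1pLoc ⊤ Ω f

/-- `f ∈ W^{1,∞}_loc(closure of Ω)`: `f` is, on `Ω`, the restriction of a function in
`W^{1,∞}_loc(ℝᵈ)`. -/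
def MemW1InftyLocClosure (Ω : Set (Rd d)) (f : Rd d → ℝ) : Prop :=
  ∃ F : Rd d → ℝ, MemW1InftyLoc univ F ∧ EqOn f F Ω

/-- The carré du champ `Γ(φ) = ∑ c_kl (∂_k φ) (∂_l φ)`, with weak derivatives on `Ω`. -/
def carreDuChamp (Ω : Set (Rd d)) (c : Rd d → Matrix (Fin d) (Fin d) ℝ) (φ : Rd d → ℝ)
    (x : Rd d) : ℝ :=
  ∑ k, ∑ l, c x k l * weakPartial Ω k φ x * weakPartial Ω l φ x

/-- The Riemannian distance `d(x;y) = sup {ψ(x) - ψ(y) : ψ ∈ W^{1,∞}_loc(Ω), Γ(ψ) ≤ 1}`, as an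
element of `[0,∞]` (the supremum is nonnegative because `ψ = 0` is admissible). -/
def riemannianDist (Ω : Set (Rd d)) (c : Rd d → Matrix (Fin d) (Fin d) ℝ) (x y : Rd d) : ℝ≥0∞ :=
  ⨆ (ψ : Rd d → ℝ) (_ : MemW1InftyLoc Ω ψ)
    (_ : ∀ᵐ z ∂(volume.restrict Ω), carreDuChamp Ω c ψ z ≤ 1), ENNReal.ofReal (ψ x - ψ y)

/-- The Riemannian ball `B(r) = {x ∈ Ω : d(x;0) < r}`. -/
def riemannianBall (Ω : Set (Rd d)) (c : Rd d → Matrix (Fin d) (Fin d) ℝ) (r : ℝ) : Set (Rd d) :=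
  {x ∈ Ω | riemannianDist Ω c x 0 < ENNReal.ofReal r}

/-- `φ ∈ D(h_N)`: `φ ∈ W^{1,2}_loc(Ω)` and `Γ(φ) + φ² ∈ L_1(Ω)`. -/
def MemFormN (Ω : Set (Rd d)) (c : Rd d → Matrix (Fin d) (Fin d) ℝ) (φ : Rd d → ℝ) : Prop :=
  MemW1pLoc 2 Ω φ ∧ IntegrableOn (fun x => carreDuChamp Ω c φ x + φ x ^ 2) Ω

/-- The form `h_N(φ) = ∫_Ω Γ(φ)`. -/
def formN (Ω : Set (Rd d)) (c : Rd d → Matrix (Fin d) (Fin d) ℝ) (φ : Rd d → ℝ) : ℝ :=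
  ∫ x in Ω, carreDuChamp Ω c φ x

/-- The square of the graph norm, `h_N(φ) + ‖φ‖₂²`. -/
def graphNormSq (Ω : Set (Rd d)) (c : Rd d → Matrix (Fin d) (Fin d) ℝ) (φ : Rd d → ℝ) : ℝ :=
  formN Ω c φ + ∫ x in Ω, φ x ^ 2

/-- The form `h(χ) = ∑ (∂_k χ, c_kl ∂_l χ)`, which has domain `C_c^∞(Ω)`. -/
def form (Ω : Set (Rd d)) (c : Rd d → Matrix (Fin d) (Fin d) ℝ) (χ : Rd d → ℝ) : ℝ :=
  ∑ k, ∑ l, ∫ x in Ω, partialDeriv k χ x * (c x k l * partialDeriv l χ x)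

/-- `φ ∈ D(h_D)`, where `h_D` is the closure of the form `h`: `φ ∈ L_2(Ω)` is the `L_2`-limit of
an `h`-Cauchy sequence in `C_c^∞(Ω)`. -/
def MemFormD (Ω : Set (Rd d)) (c : Rd d → Matrix (Fin d) (Fin d) ℝ) (φ : Rd d → ℝ) : Prop :=
  MemLp φ 2 (volume.restrict Ω) ∧
    ∃ χ : ℕ → Rd d → ℝ, (∀ n, IsTestFunction Ω (χ n)) ∧
      Tendsto (fun n => eLpNorm (χ n - φ) 2 (volume.restrict Ω)) atTop (𝓝 0) ∧
      Tendsto (fun p : ℕ × ℕ => form Ω c (χ p.1 - χ p.2)) atTop (𝓝 0)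

/-- The condition `𝒞_A`.  The norms `‖1_A f‖_p` of functions on `Ω` are the `L_p`-norms over
`A ∩ Ω`. -/
def ConditionC (Ω : Set (Rd d)) (c : Rd d → Matrix (Fin d) (Fin d) ℝ) (A : Set (Rd d)) : Prop :=
  ∃ η : ℕ → Rd d → ℝ, (∀ n, MemFormD Ω c (η n)) ∧
    (∀ φ : Rd d → ℝ, MemLp φ 2 (volume.restrict Ω) →
      Tendsto (fun n => eLpNorm (fun x => (1 - η n x) * φ x) 2 (volume.restrict (A ∩ Ω)))
        atTop (𝓝 0)) ∧
    Tendsto (fun n => eLpNorm (carreDuChamp Ω c (η n)) 1 (volume.restrict (A ∩ Ω))) atTop (𝓝 0)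

/-- The capacity of a subset `A` of the closure of `Ω`; it is `∞` if no `ψ` is admissible. -/
def capacity (Ω : Set (Rd d)) (c : Rd d → Matrix (Fin d) (Fin d) ℝ) (A : Set (Rd d)) : ℝ≥0∞ :=
  ⨅ (ψ : Rd d → ℝ) (_ : MemFormN Ω c ψ)
    (_ : ∀ᵐ x ∂(volume.restrict Ω), 0 ≤ ψ x ∧ ψ x ≤ 1)
    (_ : ∃ U : Set (Rd d), IsOpen U ∧ A ⊆ U ∧ ∀ᵐ x ∂(volume.restrict (U ∩ Ω)), ψ x = 1),
    ENNReal.ofReal (graphNormSq Ω c ψ)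

end DiffusionCapacity

end

noncomputable section

namespace DiffusionCapacity

variable {d : ℕ}

/-! ### Classical partial derivatives -/

/-! Both implications rest on one exchange: a function of small form norm that equals 1 near
`frontier Ω` is, up to cutoffs, one minus an element of D(h_D) that is close to 1 on bounded sets.

If the capacity vanishes, there are admissible ψ of arbitrarily small norm with ψ = 1 on an open U
containing the boundary. For bounded A the part of `closure A ∩ closure Ω` outside U is a compact
subset of Ω, so some test function σ is 1 near it. Put η = σ(1 - ψ). It has compact support in Ω,
and mollification puts it in D(h_D) (`memFormD_of_hasWeakPartial`). On `closure A ∩ Ω`, almost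
everywhere, 1 - η = ψ and Γ(η) ≤ Γ(ψ): off U because σ = 1 locally, on U because 1 - ψ = 0 kills the
derivative of σ (`exists_memFormD_of_eq_one_near_frontier`). An almost everywhere convergent
subsequence of the ψ and dominated convergence give 𝒞_A.

Conversely, let ρ be a smooth compactly supported cutoff. Condition 𝒞_A on its support gives η in
D(h_D) near 1 there with small Γ(η). Closability (`MemFormD.exists_approx`) replaces η by a test
function χ, and ρ(1 - χ) has small energy, since ρ and Γ(ρ) are bounded on Ω
(`exists_energy_mul_one_sub_le`). As χ vanishes near the boundary, ρ(1 - χ) = ρ there. Summing over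
a locally finite smooth partition of unity, with errors decaying fast enough, gives a smooth
function of small energy that is 1 near the whole boundary, which may be unbounded. A smooth
truncation to [0,1] makes it admissible for the capacity (`capacity_frontier_le`). -/

lemma continuous_partialDeriv {f : Rd d → ℝ} (hf : ContDiff ℝ ∞ f) (k : Fin d) :
    Continuous (partialDeriv k f) :=
  (hf.continuous_fderiv (by simp)).clm_apply continuous_const

lemma contDiff_partialDeriv {f : Rd d → ℝ} (hf : ContDiff ℝ ∞ f) (k : Fin d) :
    ContDiff ℝ ∞ (partialDeriv k f) :=
  (hf.fderiv_right (m := ∞) (by simp)).clm_apply contDiff_const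

lemma support_partialDeriv_subset (f : Rd d → ℝ) (k : Fin d) :
    Function.support (partialDeriv k f) ⊆ tsupport f := by
  intro x hx
  by_contra h
  exact hx (by simp [partialDeriv, fderiv_of_notMem_tsupport ℝ h])

lemma tsupport_partialDeriv_subset (f : Rd d → ℝ) (k : Fin d) :
    tsupport (partialDeriv k f) ⊆ tsupport f :=
  closure_minimal (support_partialDeriv_subset f k) (isClosed_tsupport f)

lemma partialDeriv_congr {f g : Rd d → ℝ} {x : Rd d} (h : f =ᶠ[𝓝 x] g) (k : Fin d) :
    partialDeriv k f x = partialDeriv k g x := by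
  simp only [partialDeriv, h.fderiv_eq]

lemma partialDeriv_mul {f g : Rd d → ℝ} {x : Rd d} (hf : DifferentiableAt ℝ f x)
    (hg : DifferentiableAt ℝ g x) (k : Fin d) :
    partialDeriv k (fun y => f y * g y) x = f x * partialDeriv k g x + g x * partialDeriv k f x := by
  simp [partialDeriv, fderiv_fun_mul hf hg]

lemma partialDeriv_sub {f g : Rd d → ℝ} {x : Rd d} (hf : DifferentiableAt ℝ f x)
    (hg : DifferentiableAt ℝ g x) (k : Fin d) :
    partialDeriv k (f - g) x = partialDeriv k f x - partialDeriv k g x := by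
  simp [partialDeriv, fderiv_sub hf hg]

lemma partialDeriv_one_sub (f : Rd d → ℝ) (x : Rd d) (k : Fin d) :
    partialDeriv k (fun y => 1 - f y) x = - partialDeriv k f x := by
  simp [partialDeriv, fderiv_const_sub]

lemma partialDeriv_finset_sum {ι : Type*} (s : Finset ι) {f : ι → Rd d → ℝ}
    (hf : ∀ i, ContDiff ℝ ∞ (f i)) (k : Fin d) (x : Rd d) :
    partialDeriv k (fun y => ∑ i ∈ s, f i y) x = ∑ i ∈ s, partialDeriv k (f i) x := by
  simp only [partialDeriv]
  rw [fderiv_fun_sum fun i _ => (hf i).differentiable (by simp) x]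
  simp

lemma partialDeriv_comp {T : ℝ → ℝ} {f : Rd d → ℝ} (hT : ContDiff ℝ ∞ T) (hf : ContDiff ℝ ∞ f)
    (k : Fin d) (x : Rd d) :
    partialDeriv k (fun y => T (f y)) x = deriv T (f x) * partialDeriv k f x := by
  have h := (hT.differentiable (by simp) (f x)).hasDerivAt.comp_hasFDerivAt x
    (hf.differentiable (by simp) x).hasFDerivAt
  have h' : HasFDerivAt (fun y => T (f y)) (deriv T (f x) • fderiv ℝ f x) x := h
  simp [partialDeriv, h'.fderiv]

/-! ### Test functions -/

namespace IsTestFunction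

variable {Ω : Set (Rd d)} {χ χ' : Rd d → ℝ}

lemma continuous (h : IsTestFunction Ω χ) : Continuous χ := h.1.continuous

lemma differentiable (h : IsTestFunction Ω χ) : Differentiable ℝ χ :=
  h.1.differentiable (by simp)

lemma mul_left {σ : Rd d → ℝ} (h : IsTestFunction Ω χ) (hσ : ContDiff ℝ ∞ σ) :
    IsTestFunction Ω (fun x => σ x * χ x) :=
  ⟨hσ.mul h.1, h.2.1.mul_left, (tsupport_mul_subset_right (f := σ) (g := χ)).trans h.2.2⟩

lemma sub (h : IsTestFunction Ω χ) (h' : IsTestFunction Ω χ') : IsTestFunction Ω (χ - χ') :=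
  ⟨h.1.sub h'.1, h.2.1.sub h'.2.1, (tsupport_sub χ χ').trans (union_subset h.2.2 h'.2.2)⟩

lemma partialDeriv (h : IsTestFunction Ω χ) (k : Fin d) : IsTestFunction Ω (partialDeriv k χ) :=
  ⟨contDiff_partialDeriv h.1 k,
    HasCompactSupport.of_support_subset_isCompact h.2.1 (support_partialDeriv_subset χ k),
    (tsupport_partialDeriv_subset χ k).trans h.2.2⟩

lemma memLp_two (h : IsTestFunction Ω χ) : MemLp χ 2 :=
  h.continuous.memLp_of_hasCompactSupport h.2.1

lemma setIntegral_mul_eq (h : IsTestFunction Ω χ) (f : Rd d → ℝ) :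
    ∫ x in Ω, f x * χ x = ∫ x, f x * χ x := by
  refine setIntegral_eq_integral_of_forall_compl_eq_zero fun x hx => ?_
  rw [image_eq_zero_of_notMem_tsupport fun hx' => hx (h.2.2 hx'), mul_zero]

lemma integrable_mul (h : IsTestFunction Ω χ) {f : Rd d → ℝ} (hf : LocallyIntegrableOn f Ω) :
    Integrable (fun x => f x * χ x) := by
  have h1 : IntegrableOn f (tsupport χ) := hf.integrableOn_compact_subset h.2.2 h.2.1
  have h2 : IntegrableOn (fun x => f x * χ x) (tsupport χ) :=
    h1.mul_continuousOn h.continuous.continuousOn h.2.1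
  refine (integrableOn_iff_integrable_of_support_subset ?_).1 h2
  exact (Function.support_mul_subset_right f χ).trans (subset_tsupport χ)

end IsTestFunction

/-- Smooth cutoff functions. -/
lemma exists_isTestFunction_one_nhds {Ω K : Set (Rd d)} (hΩ : IsOpen Ω) (hK : IsCompact K)
    (hKΩ : K ⊆ Ω) :
    ∃ σ : Rd d → ℝ, IsTestFunction Ω σ ∧ (∀ x, σ x ∈ Icc (0 : ℝ) 1) ∧
      ∀ x ∈ K, ∀ᶠ y in 𝓝 x, σ y = 1 := by
  obtain ⟨L, hL, hKL, hLΩ⟩ := exists_compact_between hK hΩ hKΩ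
  obtain ⟨f, hf1, hf0, hf⟩ := exists_contMDiffMap_one_nhds_of_subset_interior (n := ⊤)
    (modelWithCornersSelf ℝ (Rd d)) hK.isClosed hKL
  have hsupp : Function.support f ⊆ L := fun x hx => by
    by_contra h
    exact hx (hf0 x h)
  refine ⟨f, ⟨f.contMDiff.contDiff, HasCompactSupport.of_support_subset_isCompact hL hsupp,
    (closure_minimal hsupp hL.isClosed).trans hLΩ⟩, hf, fun x hx => ?_⟩
  exact (eventually_nhdsSet_iff_forall.1 hf1) x hx

/-! ### Weak derivatives -/

namespace HasWeakPartial

variable {Ω : Set (Rd d)} {k : Fin d} {f f' g g' : Rd d → ℝ}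

/-- Weak derivatives are unique up to null sets. -/
lemma ae_unique (hΩ : IsOpen Ω) (h : HasWeakPartial Ω k f g) (h' : HasWeakPartial Ω k f g') :
    g =ᵐ[volume.restrict Ω] g' := by
  have key : ∀ᵐ x : Rd d, x ∈ Ω → (g - g') x = 0 := by
    refine hΩ.ae_eq_zero_of_integral_contDiff_smul_eq_zero (h.2.1.sub h'.2.1) ?_
    intro χ h1 h2 h3
    have hχ : IsTestFunction Ω χ := ⟨h1, h2, h3⟩
    have e1 := h.2.2 χ hχ
    rw [h'.2.2 χ hχ, hχ.setIntegral_mul_eq, hχ.setIntegral_mul_eq, neg_inj] at e1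
    have : ∀ x, χ x • (g - g') x = g x * χ x - g' x * χ x := fun x => by
      simp only [Pi.sub_apply, smul_eq_mul]; ring
    simp only [this]
    rw [integral_sub (hχ.integrable_mul h.2.1) (hχ.integrable_mul h'.2.1), e1, sub_self]
  rw [EventuallyEq, ae_restrict_iff' hΩ.measurableSet]
  filter_upwards [key] with x hx hxΩ
  exact sub_eq_zero.1 (hx hxΩ)

/-- `weakPartial` is an arbitrary choice; uniqueness lets any explicit weak derivative stand in for
it almost everywhere. -/
lemma weakPartial_ae_eq (hΩ : IsOpen Ω) (h : HasWeakPartial Ω k f g) :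
    weakPartial Ω k f =ᵐ[volume.restrict Ω] g :=
  h.weakPartial_spec.ae_unique hΩ h

lemma of_contDiff (hf : ContDiff ℝ ∞ f) (k : Fin d) : HasWeakPartial Ω k f (partialDeriv k f) := by
  have hfi : LocallyIntegrable f := hf.continuous.locallyIntegrable
  have hgi : LocallyIntegrable (DiffusionCapacity.partialDeriv k f) :=
    (continuous_partialDeriv hf k).locallyIntegrable
  refine ⟨hfi.locallyIntegrableOn Ω, hgi.locallyIntegrableOn Ω, fun χ hχ => ?_⟩
  rw [hχ.setIntegral_mul_eq, (hχ.partialDeriv k).setIntegral_mul_eq]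
  exact integral_mul_fderiv_eq_neg_fderiv_mul_of_integrable
    (hχ.integrable_mul (hgi.locallyIntegrableOn Ω))
    ((hχ.partialDeriv k).integrable_mul (hfi.locallyIntegrableOn Ω))
    (hχ.integrable_mul (hfi.locallyIntegrableOn Ω))
    (fun x _ => hf.differentiable (by simp) x) (fun x _ => hχ.differentiable x)

lemma sub (h : HasWeakPartial Ω k f g) (h' : HasWeakPartial Ω k f' g') :
    HasWeakPartial Ω k (f - f') (g - g') := by
  refine ⟨h.1.sub h'.1, h.2.1.sub h'.2.1, fun χ hχ => ?_⟩
  have hχ' := hχ.partialDeriv k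
  have e1 := h.2.2 χ hχ
  have e2 := h'.2.2 χ hχ
  simp only [Pi.sub_apply, sub_mul]
  rw [integral_sub (hχ'.integrable_mul h.1).integrableOn (hχ'.integrable_mul h'.1).integrableOn,
    integral_sub (hχ.integrable_mul h.2.1).integrableOn (hχ.integrable_mul h'.2.1).integrableOn,
    e1, e2]
  ring

lemma one_sub (h : HasWeakPartial Ω k f g) :
    HasWeakPartial Ω k (fun x => 1 - f x) (fun x => - g x) := by
  have h1 := (of_contDiff (Ω := Ω) (contDiff_const (c := (1 : ℝ))) k).sub h
  have e : (fun x => - g x) = DiffusionCapacity.partialDeriv k (fun _ => (1 : ℝ)) - g := by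
    ext x
    simp [DiffusionCapacity.partialDeriv]
  rw [e]
  exact h1

/-- The product with a test function on `Ω` is weakly differentiable on all of `ℝᵈ`. -/
lemma testFunction_mul {σ : Rd d → ℝ} (h : HasWeakPartial Ω k f g) (hσ : IsTestFunction Ω σ) :
    HasWeakPartial univ k (fun x => σ x * f x)
      (fun x => σ x * g x + f x * DiffusionCapacity.partialDeriv k σ x) := by
  have i1 : Integrable (fun x => σ x * f x) := by
    simpa only [mul_comm] using hσ.integrable_mul h.1
  have i2 : Integrable (fun x => σ x * g x) := by
    simpa only [mul_comm] using hσ.integrable_mul h.2.1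
  have i3 := (hσ.partialDeriv k).integrable_mul h.1
  refine ⟨i1.locallyIntegrable.locallyIntegrableOn _,
    (i2.add i3).locallyIntegrable.locallyIntegrableOn _, fun χ hχ => ?_⟩
  -- The product χσ is supported in Ω even when χ is not, so it may be inserted into the weak
  -- identity for `f`; the product rule then separates the two terms.
  have hσχ : IsTestFunction Ω (fun x => χ x * σ x) := hσ.mul_left hχ.1
  have hσ'χ := (hσ.partialDeriv k).mul_left hχ.1
  have hσχ' := hσ.mul_left (hχ.partialDeriv k).1
  have e := h.2.2 _ hσχ
  rw [hσχ.setIntegral_mul_eq, (hσχ.partialDeriv k).setIntegral_mul_eq] at e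
  simp only [Measure.restrict_univ]
  have e1 : ∀ x, f x * DiffusionCapacity.partialDeriv k (fun x => χ x * σ x) x
      = f x * (χ x * DiffusionCapacity.partialDeriv k σ x)
        + f x * (DiffusionCapacity.partialDeriv k χ x * σ x) := fun x => by
    rw [partialDeriv_mul (hχ.differentiable x) (hσ.differentiable x)]; ring
  simp only [e1] at e
  rw [integral_add (hσ'χ.integrable_mul h.1) (hσχ'.integrable_mul h.1)] at e
  have e2 : ∀ x, (σ x * g x + f x * DiffusionCapacity.partialDeriv k σ x) * χ x
      = g x * (χ x * σ x) + f x * (χ x * DiffusionCapacity.partialDeriv k σ x) := fun x => by ring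
  have e3 : ∀ x, σ x * f x * DiffusionCapacity.partialDeriv k χ x
      = f x * (DiffusionCapacity.partialDeriv k χ x * σ x) := fun x => by ring
  simp only [e2, e3]
  rw [integral_add (hσχ.integrable_mul h.2.1) (hσ'χ.integrable_mul h.1)]
  linarith

/-- Integrals against a test function see only its support, so the ambient set is immaterial. This
carries the product rule of `testFunction_mul` from ℝᵈ back to Ω. -/
lemma mono {Ω' : Set (Rd d)} (h : HasWeakPartial Ω k f g) (hs : Ω' ⊆ Ω) :
    HasWeakPartial Ω' k f g := by
  refine ⟨h.1.mono_set hs, h.2.1.mono_set hs, fun χ hχ => ?_⟩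
  have hχ' : IsTestFunction Ω χ := ⟨hχ.1, hχ.2.1, hχ.2.2.trans hs⟩
  have e := h.2.2 χ hχ'
  rwa [hχ'.setIntegral_mul_eq, (hχ'.partialDeriv k).setIntegral_mul_eq,
    ← hχ.setIntegral_mul_eq, ← (hχ.partialDeriv k).setIntegral_mul_eq] at e

end HasWeakPartial

/-! ### The quadratic form of the coefficients -/

/-- The quadratic form `∑ c_kl(x) v_k v_l`. -/
def quad (c : Rd d → Matrix (Fin d) (Fin d) ℝ) (x : Rd d) (v : Fin d → ℝ) : ℝ :=
  ∑ k, ∑ l, c x k l * v k * v l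

/-- The classical gradient. -/
def grad (f : Rd d → ℝ) (x : Rd d) : Fin d → ℝ := fun k => partialDeriv k f x

/-- The weak gradient on `Ω`. -/
def weakGrad (Ω : Set (Rd d)) (f : Rd d → ℝ) (x : Rd d) : Fin d → ℝ := fun k => weakPartial Ω k f x

section quad

variable {Ω : Set (Rd d)} {c : Rd d → Matrix (Fin d) (Fin d) ℝ}

lemma carreDuChamp_eq_quad (φ : Rd d → ℝ) (x : Rd d) :
    carreDuChamp Ω c φ x = quad c x (weakGrad Ω φ x) := rfl

lemma dotProduct_mulVec_eq_quad (x : Rd d) (v : Fin d → ℝ) :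
    star v ⬝ᵥ (c x).mulVec v = quad c x v := by
  simp only [quad, dotProduct, Matrix.mulVec, Finset.mul_sum, star_trivial]
  exact Finset.sum_congr rfl fun k _ => Finset.sum_congr rfl fun l _ => by ring

lemma quad_nonneg (hpos : ∀ x ∈ Ω, (c x).PosDef) {x : Rd d} (hx : x ∈ Ω) (v : Fin d → ℝ) :
    0 ≤ quad c x v := by
  have h := (hpos x hx).posSemidef.dotProduct_mulVec_nonneg v
  rwa [dotProduct_mulVec_eq_quad] at h

lemma quad_pos (hpos : ∀ x ∈ Ω, (c x).PosDef) {x : Rd d} (hx : x ∈ Ω) {v : Fin d → ℝ}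
    (hv : v ≠ 0) : 0 < quad c x v := by
  have h := (hpos x hx).dotProduct_mulVec_pos hv
  rwa [dotProduct_mulVec_eq_quad] at h

lemma quad_smul (x : Rd d) (t : ℝ) (v : Fin d → ℝ) : quad c x (t • v) = t ^ 2 * quad c x v := by
  simp only [quad, Finset.mul_sum, Pi.smul_apply, smul_eq_mul]
  exact Finset.sum_congr rfl fun k _ => Finset.sum_congr rfl fun l _ => by ring

lemma quad_neg (x : Rd d) (v : Fin d → ℝ) : quad c x (-v) = quad c x v := by
  simp [quad]

lemma quad_parallelogram (x : Rd d) (v w : Fin d → ℝ) :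
    quad c x (v + w) + quad c x (v - w) = 2 * quad c x v + 2 * quad c x w := by
  simp only [quad, Finset.mul_sum, ← Finset.sum_add_distrib, Pi.add_apply, Pi.sub_apply]
  exact Finset.sum_congr rfl fun k _ => Finset.sum_congr rfl fun l _ => by ring

/-- The parallelogram identity with the nonnegative term `quad c x (v - w)` dropped. It replaces the
triangle inequality throughout, at the price of factors 2. -/
lemma quad_add_le (hpos : ∀ x ∈ Ω, (c x).PosDef) {x : Rd d} (hx : x ∈ Ω) (v w : Fin d → ℝ) :
    quad c x (v + w) ≤ 2 * quad c x v + 2 * quad c x w := by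
  have h1 := quad_parallelogram (c := c) x v w
  have h2 := quad_nonneg hpos hx (v - w)
  linarith

lemma continuous_quad_apply (x : Rd d) : Continuous (quad c x) := by
  unfold quad
  fun_prop

/-- Local ellipticity. -/
lemma exists_quad_ge (hpos : ∀ x ∈ Ω, (c x).PosDef)
    (hcont : ∀ k l, ContinuousOn (fun x => c x k l) Ω) {K : Set (Rd d)} (hK : IsCompact K)
    (hKΩ : K ⊆ Ω) : ∃ κ : ℝ, 0 < κ ∧ ∀ x ∈ K, ∀ v : Fin d → ℝ, ∀ k, κ * v k ^ 2 ≤ quad c x v := by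
  have hS : IsCompact (Metric.sphere (0 : Fin d → ℝ) 1) := isCompact_sphere _ _
  have hcq : ContinuousOn (fun p : Rd d × (Fin d → ℝ) => quad c p.1 p.2)
      (K ×ˢ Metric.sphere (0 : Fin d → ℝ) 1) := by
    unfold quad
    refine continuousOn_finsetSum _ fun k _ => continuousOn_finsetSum _ fun l _ => ?_
    refine ContinuousOn.mul (ContinuousOn.mul ?_ (by fun_prop)) (by fun_prop)
    exact (hcont k l).comp continuousOn_fst fun p hp => hKΩ hp.1
  have hne : ∀ v : Fin d → ℝ, v ∈ Metric.sphere (0 : Fin d → ℝ) 1 → v ≠ 0 := by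
    rintro v hv rfl
    simp at hv
  obtain ⟨κ, hκ, hle⟩ : ∃ κ : ℝ, 0 < κ ∧
      ∀ p ∈ K ×ˢ Metric.sphere (0 : Fin d → ℝ) 1, κ ≤ quad c p.1 p.2 := by
    -- The product is empty when `K` is empty or `d = 0`. Otherwise the minimum over it is attained
    -- and positive, and homogeneity extends the bound to all vectors.
    rcases (K ×ˢ Metric.sphere (0 : Fin d → ℝ) 1).eq_empty_or_nonempty with h | h
    · exact ⟨1, one_pos, by simp [h]⟩
    · obtain ⟨p, hp, hmin⟩ := (hK.prod hS).exists_isMinOn h hcq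
      exact ⟨quad c p.1 p.2, quad_pos hpos (hKΩ hp.1) (hne _ hp.2), fun q hq => hmin hq⟩
  refine ⟨κ, hκ, fun x hx v k => ?_⟩
  rcases eq_or_ne v 0 with rfl | hv
  · simp [quad]
  have hn : 0 < ‖v‖ := norm_pos_iff.2 hv
  have h1 := hle (x, ‖v‖⁻¹ • v) ⟨hx, by simp [norm_smul, hn.ne']⟩
  have h2 : quad c x v = ‖v‖ ^ 2 * quad c x (‖v‖⁻¹ • v) := by
    rw [quad_smul]; field_simp
  have h3 : v k ^ 2 ≤ ‖v‖ ^ 2 := by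
    rw [← sq_abs (v k), ← Real.norm_eq_abs]
    exact pow_le_pow_left₀ (norm_nonneg _) (norm_le_pi_norm v k) 2
  calc κ * v k ^ 2 ≤ κ * ‖v‖ ^ 2 := by gcongr
    _ = ‖v‖ ^ 2 * κ := mul_comm _ _
    _ ≤ quad c x v := by rw [h2]; gcongr

lemma exists_quad_le (hcont : ∀ k l, ContinuousOn (fun x => c x k l) Ω) {K : Set (Rd d)}
    (hK : IsCompact K) (hKΩ : K ⊆ Ω) :
    ∃ M : ℝ, 0 ≤ M ∧ ∀ x ∈ K, ∀ v : Fin d → ℝ, quad c x v ≤ M * ∑ k, v k ^ 2 := by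
  have hb : ∀ k l, ∃ M : ℝ, ∀ x ∈ K, ‖c x k l‖ ≤ M := fun k l =>
    hK.exists_bound_of_continuousOn ((hcont k l).mono hKΩ)
  choose M hM using hb
  refine ⟨∑ k, ∑ l, |M k l|, by positivity, fun x hx v => ?_⟩
  rw [quad, Finset.sum_mul]
  refine Finset.sum_le_sum fun k _ => ?_
  rw [Finset.sum_mul]
  refine Finset.sum_le_sum fun l _ => ?_
  have h1 : |v k * v l| ≤ ∑ i, v i ^ 2 := by
    have hk : v k ^ 2 ≤ ∑ i, v i ^ 2 :=
      Finset.single_le_sum (f := fun i => v i ^ 2) (fun i _ => sq_nonneg _) (Finset.mem_univ k)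
    have hl : v l ^ 2 ≤ ∑ i, v i ^ 2 :=
      Finset.single_le_sum (f := fun i => v i ^ 2) (fun i _ => sq_nonneg _) (Finset.mem_univ l)
    rw [abs_mul]
    nlinarith [sq_nonneg (|v k| - |v l|), sq_abs (v k), sq_abs (v l)]
  calc c x k l * v k * v l ≤ |c x k l * v k * v l| := le_abs_self _
    _ = |c x k l| * |v k * v l| := by rw [mul_assoc, abs_mul]
    _ ≤ |M k l| * ∑ i, v i ^ 2 :=
      mul_le_mul ((hM k l x hx).trans (le_abs_self _)) h1 (abs_nonneg _) (abs_nonneg _)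

lemma grad_sub {f g : Rd d → ℝ} (hf : Differentiable ℝ f) (hg : Differentiable ℝ g) (x : Rd d) :
    grad (f - g) x = grad f x - grad g x :=
  funext fun k => partialDeriv_sub (hf x) (hg x) k

lemma aestronglyMeasurable_quad (hΩ : IsOpen Ω)
    (hcont : ∀ k l, ContinuousOn (fun x => c x k l) Ω) {v : Rd d → Fin d → ℝ}
    (hv : ∀ k, AEStronglyMeasurable (fun x => v x k) (volume.restrict Ω)) :
    AEStronglyMeasurable (fun x => quad c x (v x)) (volume.restrict Ω) := by
  unfold quad
  refine Finset.aestronglyMeasurable_fun_sum _ fun k _ =>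
    Finset.aestronglyMeasurable_fun_sum _ fun l _ => ?_
  exact (((hcont k l).aestronglyMeasurable hΩ.measurableSet).mul (hv k)).mul (hv l)

lemma aestronglyMeasurable_grad {f : Rd d → ℝ} (hf : ContDiff ℝ ∞ f) (k : Fin d) (μ : Measure (Rd d)) :
    AEStronglyMeasurable (fun x => grad f x k) μ :=
  (continuous_partialDeriv hf k).aestronglyMeasurable

lemma form_eq_integral (hΩ : IsOpen Ω) (hcont : ∀ k l, ContinuousOn (fun x => c x k l) Ω)
    {χ : Rd d → ℝ} (hχ : IsTestFunction Ω χ) :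
    IntegrableOn (fun x => quad c x (grad χ x)) Ω ∧
      form Ω c χ = ∫ x in Ω, quad c x (grad χ x) := by
  have hi : ∀ k l, IntegrableOn (fun x => c x k l * grad χ x k * grad χ x l) Ω := fun k l => by
    have h1 : LocallyIntegrableOn (fun x => c x k l) Ω :=
      (hcont k l).locallyIntegrableOn hΩ.measurableSet
    have h2 := (((hχ.partialDeriv l).mul_left (hχ.partialDeriv k).1)).integrable_mul h1
    exact h2.integrableOn.congr (Eventually.of_forall fun x => by simp only [grad]; ring)
  refine ⟨integrable_finsetSum _ fun k _ => integrable_finsetSum _ fun l _ => hi k l, ?_⟩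
  unfold form quad
  rw [integral_finsetSum _ fun k _ => integrable_finsetSum _ fun l _ => hi k l]
  refine Finset.sum_congr rfl fun k _ => ?_
  rw [integral_finsetSum _ fun l _ => hi k l]
  refine Finset.sum_congr rfl fun l _ => integral_congr_ae (Eventually.of_forall fun x => ?_)
  simp only [grad]
  ring

lemma form_nonneg (hΩ : IsOpen Ω) (hpos : ∀ x ∈ Ω, (c x).PosDef)
    (hcont : ∀ k l, ContinuousOn (fun x => c x k l) Ω) {χ : Rd d → ℝ} (hχ : IsTestFunction Ω χ) :
    0 ≤ form Ω c χ := by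
  rw [(form_eq_integral hΩ hcont hχ).2]
  exact setIntegral_nonneg hΩ.measurableSet fun x hx => quad_nonneg hpos hx _

/-- On test functions the form is the integral of the quadratic form. -/
lemma ofReal_form (hΩ : IsOpen Ω) (hpos : ∀ x ∈ Ω, (c x).PosDef)
    (hcont : ∀ k l, ContinuousOn (fun x => c x k l) Ω) {χ : Rd d → ℝ} (hχ : IsTestFunction Ω χ) :
    ENNReal.ofReal (form Ω c χ) = ∫⁻ x in Ω, ENNReal.ofReal (quad c x (grad χ x)) := by
  obtain ⟨h1, h2⟩ := form_eq_integral hΩ hcont hχ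
  rw [h2, ofReal_integral_eq_lintegral_ofReal h1]
  exact (ae_restrict_mem hΩ.measurableSet).mono fun x hx => quad_nonneg hpos hx _

end quad

/-! ### Mollification in `L₂` -/

lemma eLpNorm_two_sq {α : Type*} {m : MeasurableSpace α} (μ : Measure α) (f : α → ℝ) :
    eLpNorm f 2 μ ^ 2 = ∫⁻ x, ENNReal.ofReal (f x ^ 2) ∂μ := by
  have h := eLpNorm_nnreal_pow_eq_lintegral (μ := μ) (f := f) (p := 2) (by simp)
  have h2 : ((2 : NNReal) : ℝ) = ((2 : ℕ) : ℝ) := by simp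
  rw [h2] at h
  simp only [ENNReal.rpow_natCast] at h
  rw [show ((2 : NNReal) : ℝ≥0∞) = 2 by simp] at h
  rw [h]
  refine lintegral_congr fun x => ?_
  rw [Real.enorm_eq_ofReal_abs, ← ENNReal.ofReal_pow (abs_nonneg _), sq_abs]

/-- Hölder's inequality against the constant 1, that is, Jensen's inequality for the square. -/
lemma sq_lintegral_le {α : Type*} {m : MeasurableSpace α} (ν : Measure α) [IsProbabilityMeasure ν]
    {f : α → ℝ≥0∞} (hf : Measurable f) : (∫⁻ x, f x ∂ν) ^ 2 ≤ ∫⁻ x, f x ^ 2 ∂ν := by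
  have h := ENNReal.lintegral_mul_le_Lp_mul_Lq ν Real.HolderConjugate.two_two hf.aemeasurable
    (g := fun _ => 1) aemeasurable_const
  simp only [Pi.mul_apply, mul_one, ENNReal.one_rpow, lintegral_const, measure_univ] at h
  calc (∫⁻ x, f x ∂ν) ^ 2 ≤ ((∫⁻ x, f x ^ (2 : ℝ) ∂ν) ^ (1 / 2 : ℝ)) ^ 2 := by gcongr
    _ = ∫⁻ x, f x ^ 2 ∂ν := by
      rw [← ENNReal.rpow_natCast, ← ENNReal.rpow_mul]
      simp

/-- The mollification of `f` by a normalised bump function. -/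
def mollify (φ : ContDiffBump (0 : Rd d)) (f : Rd d → ℝ) : Rd d → ℝ :=
  convolution (φ.normed volume) f (ContinuousLinearMap.lsmul ℝ ℝ) volume

lemma mollify_apply (φ : ContDiffBump (0 : Rd d)) (f : Rd d → ℝ) (x : Rd d) :
    mollify φ f x = ∫ t, φ.normed volume t * f (x - t) := rfl

lemma mollify_apply_swap (φ : ContDiffBump (0 : Rd d)) (f : Rd d → ℝ) (x : Rd d) :
    mollify φ f x = ∫ t, φ.normed volume (x - t) * f t := by
  rw [mollify, convolution_eq_swap]
  rfl

/-- The mollifier is a probability density `w`. Jensen's inequality bounds the square of the average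
by the average of the squares; Tonelli and translation invariance then remove the average. -/
lemma eLpNorm_mollify_le (φ : ContDiffBump (0 : Rd d)) {f : Rd d → ℝ}
    (hf : AEStronglyMeasurable f volume) : eLpNorm (mollify φ f) 2 ≤ eLpNorm f 2 := by
  -- Joint measurability of the double integrand needs a genuinely measurable representative;
  -- neither side changes on passing to one.
  wlog hm : StronglyMeasurable f generalizing f
  · have h := this hf.stronglyMeasurable_mk.aestronglyMeasurable hf.stronglyMeasurable_mk
    rwa [mollify, ← convolution_congr _ (EventuallyEq.refl _ _) hf.ae_eq_mk,
      ← eLpNorm_congr_ae hf.ae_eq_mk] at h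
  have hfm : Measurable f := hm.measurable
  set w : Rd d → ℝ≥0∞ := fun t => ‖φ.normed volume t‖ₑ with hw
  have hwm : Measurable w := φ.continuous_normed.measurable.enorm
  have hw1 : ∫⁻ t, w t = 1 := by
    have e : ∀ t, w t = ENNReal.ofReal (φ.normed volume t) := fun t => by
      rw [hw]
      exact Real.enorm_eq_ofReal (φ.nonneg_normed t)
    simp only [e]
    rw [← ofReal_integral_eq_lintegral_ofReal φ.integrable_normed
      (Eventually.of_forall φ.nonneg_normed), φ.integral_normed, ENNReal.ofReal_one]
  have hprob : IsProbabilityMeasure (volume.withDensity w) :=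
    ⟨by rw [withDensity_apply _ MeasurableSet.univ, Measure.restrict_univ, hw1]⟩
  have key : eLpNorm (mollify φ f) 2 ^ 2 ≤ eLpNorm f 2 ^ 2 := by
    rw [eLpNorm_two_sq, eLpNorm_two_sq]
    have e : ∀ a : ℝ, ENNReal.ofReal (a ^ 2) = ‖a‖ₑ ^ 2 := fun a => by
      rw [Real.enorm_eq_ofReal_abs, ← ENNReal.ofReal_pow (abs_nonneg _), sq_abs]
    simp only [e]
    calc ∫⁻ x, ‖mollify φ f x‖ₑ ^ 2
        ≤ ∫⁻ x, ∫⁻ t, w t * ‖f (x - t)‖ₑ ^ 2 := by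
          refine lintegral_mono fun x => ?_
          have hmx : Measurable fun t => ‖f (x - t)‖ₑ := by fun_prop
          have h1 : ‖mollify φ f x‖ₑ ≤ ∫⁻ t, w t * ‖f (x - t)‖ₑ := by
            rw [mollify_apply]
            refine (enorm_integral_le_lintegral_enorm _).trans_eq (lintegral_congr fun t => ?_)
            rw [enorm_mul]
          have h2 := sq_lintegral_le (volume.withDensity w) hmx
          rw [lintegral_withDensity_eq_lintegral_mul _ hwm hmx,
            lintegral_withDensity_eq_lintegral_mul _ hwm (hmx.pow_const 2)] at h2
          calc ‖mollify φ f x‖ₑ ^ 2 ≤ (∫⁻ t, w t * ‖f (x - t)‖ₑ) ^ 2 := by gcongr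
            _ ≤ _ := h2
      _ = ∫⁻ t, ∫⁻ x, w t * ‖f (x - t)‖ₑ ^ 2 := by
          refine lintegral_lintegral_swap (Measurable.aemeasurable ?_)
          simp only [Function.uncurry_def]
          fun_prop
      _ = ∫⁻ t, w t * ∫⁻ x, ‖f x‖ₑ ^ 2 := by
          refine lintegral_congr fun t => ?_
          rw [lintegral_const_mul _ (by fun_prop),
            lintegral_sub_right_eq_self (fun x => ‖f x‖ₑ ^ 2) t]
      _ = ∫⁻ x, ‖f x‖ₑ ^ 2 := by
          rw [lintegral_mul_const _ hwm, hw1, one_mul]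
  exact (ENNReal.pow_le_pow_left_iff two_ne_zero).1 key

lemma support_mollify_subset (φ : ContDiffBump (0 : Rd d)) (f : Rd d → ℝ) :
    Function.support (mollify φ f) ⊆ Metric.cthickening φ.rOut (tsupport f) := by
  intro x hx
  obtain ⟨a, ha, b, hb, rfl⟩ := support_convolution_subset (ContinuousLinearMap.lsmul ℝ ℝ) hx
  have ha' : a ∈ Metric.ball (0 : Rd d) φ.rOut := by rwa [← φ.support_normed_eq (μ := volume)]
  refine Metric.mem_cthickening_of_dist_le _ b _ _ (subset_tsupport f hb) ?_
  have : dist (a + b) b = ‖a‖ := by simp [dist_eq_norm]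
  rw [this]
  exact (mem_ball_zero_iff.1 ha').le

/-- Mollifications converge in `L₂`. -/
lemma exists_eLpNorm_mollify_sub_le {f : Rd d → ℝ} (hf : MemLp f 2) {ε : ℝ≥0∞} (hε : ε ≠ 0) :
    ∃ δ > 0, ∀ φ : ContDiffBump (0 : Rd d), φ.rOut < δ → eLpNorm (mollify φ f - f) 2 ≤ ε := by
  have hε3 : ε / 3 ≠ 0 := by simp [hε]
  obtain ⟨h, hsupp, hfh, hcont, hh⟩ := hf.exists_hasCompactSupport_eLpNorm_sub_le (by simp) hε3
  have hKc : IsCompact (Metric.cthickening 1 (tsupport h)) := hsupp.isCompact.cthickening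
  set K := Metric.cthickening 1 (tsupport h)
  -- A uniform error `a` on `K` costs at most ε/3 in L₂. The thickening by 1 makes `K` contain the
  -- supports of all mollifications of `h` of radius at most 1.
  obtain ⟨a, ha, haK⟩ : ∃ a : ℝ, 0 < a ∧
      ENNReal.ofReal a * volume K ^ (1 / (2 : ℝ≥0∞).toReal) ≤ ε / 3 := by
    have hfin : volume K ^ (1 / (2 : ℝ≥0∞).toReal) ≠ ⊤ :=
      ENNReal.rpow_ne_top_of_nonneg (by simp) hKc.measure_lt_top.ne
    have ht : Tendsto (fun a : ℝ => ENNReal.ofReal a * volume K ^ (1 / (2 : ℝ≥0∞).toReal))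
        (𝓝[>] 0) (𝓝 0) := by
      have h1 : Tendsto (fun a : ℝ => ENNReal.ofReal a) (𝓝[>] 0) (𝓝 0) := by
        simpa using (ENNReal.tendsto_ofReal (tendsto_id (x := 𝓝 (0 : ℝ)))).mono_left
          nhdsWithin_le_nhds
      simpa using ENNReal.Tendsto.mul_const h1 (Or.inr hfin)
    obtain ⟨a, h1, h2⟩ := ((ht.eventually (ge_mem_nhds (pos_iff_ne_zero.2 hε3))).and
      self_mem_nhdsWithin).exists
    exact ⟨a, h2, h1⟩
  obtain ⟨δ, hδ, hδu⟩ := Metric.uniformContinuous_iff.1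
    (hsupp.uniformContinuous_of_continuous hcont) a ha
  refine ⟨min δ 1, lt_min hδ one_pos, fun φ hφ => ?_⟩
  have hφ1 : φ.rOut ≤ 1 := (hφ.trans_le (min_le_right _ _)).le
  have hφδ : φ.rOut < δ := hφ.trans_le (min_le_left _ _)
  have hr : MemLp (f - h) 2 := hf.sub hh
  have conv : ∀ g : Rd d → ℝ, MemLp g 2 → ConvolutionExists (φ.normed volume) g
      (ContinuousLinearMap.lsmul ℝ ℝ) volume := fun g hg =>
    φ.hasCompactSupport_normed.convolutionExists_left _ φ.continuous_normed
      (hg.locallyIntegrable (by simp))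
  have hsmooth : ∀ g : Rd d → ℝ, MemLp g 2 → AEStronglyMeasurable (mollify φ g) volume :=
    fun g hg => (φ.hasCompactSupport_normed.contDiff_convolution_left (n := 0) _
      φ.contDiff_normed (hg.locallyIntegrable (by simp))).continuous.aestronglyMeasurable
  have e : mollify φ f - f = (mollify φ (f - h) + (mollify φ h - h)) - (f - h) := by
    have e1 : mollify φ f = mollify φ (f - h) + mollify φ h := by
      have := (conv _ hr).distrib_add (conv _ hh)
      rwa [sub_add_cancel] at this
    rw [e1]
    abel
  have h1 : eLpNorm (mollify φ (f - h)) 2 ≤ ε / 3 :=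
    (eLpNorm_mollify_le φ hr.aestronglyMeasurable).trans hfh
  have h2 : eLpNorm (mollify φ h - h) 2 ≤ ε / 3 := by
    refine (eLpNorm_sub_le_of_dist_bdd volume (by simp) hKc.measurableSet ha.le
      (fun x => ?_) ?_ ?_).trans haK
    · exact φ.dist_normed_convolution_le hcont.aestronglyMeasurable fun y hy =>
        (hδu ((Metric.mem_ball.1 hy).trans hφδ)).le
    · exact (support_mollify_subset φ h).trans (Metric.cthickening_mono hφ1 _)
    · exact (subset_tsupport h).trans (Metric.self_subset_cthickening _)
  rw [e]
  refine (eLpNorm_sub_le ((hsmooth _ hr).add ((hsmooth _ hh).sub hh.aestronglyMeasurable))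
    hr.aestronglyMeasurable (by simp)).trans ?_
  calc _ ≤ (ε / 3 + ε / 3) + ε / 3 := by
        refine add_le_add ((eLpNorm_add_le (hsmooth _ hr)
          ((hsmooth _ hh).sub hh.aestronglyMeasurable) (by simp)).trans (add_le_add h1 h2)) hfh
    _ = ε := ENNReal.add_thirds ε

lemma contDiff_mollify (φ : ContDiffBump (0 : Rd d)) {f : Rd d → ℝ} (hf : LocallyIntegrable f) :
    ContDiff ℝ ∞ (mollify φ f) :=
  φ.hasCompactSupport_normed.contDiff_convolution_left _ φ.contDiff_normed hf

/-- Mollification commutes with weak derivatives. -/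
lemma partialDeriv_mollify (φ : ContDiffBump (0 : Rd d)) {f g : Rd d → ℝ} {k : Fin d}
    (h : HasWeakPartial univ k f g) : partialDeriv k (mollify φ f) = mollify φ g := by
  ext x
  have hf : LocallyIntegrable f := locallyIntegrableOn_univ.1 h.1
  have hφs : ContDiff ℝ ∞ (φ.normed (volume : Measure (Rd d))) := φ.contDiff_normed
  have hd := φ.hasCompactSupport_normed.hasFDerivAt_convolution_left
    (ContinuousLinearMap.lsmul ℝ ℝ) (hφs.of_le (by simp)) hf x
  have hex := (φ.hasCompactSupport_normed (μ := volume)).fderiv (𝕜 := ℝ)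
    |>.convolutionExists_left ((ContinuousLinearMap.lsmul ℝ ℝ).precompL (Rd d))
      (hφs.continuous_fderiv (by simp)) hf x
  -- The reflected mollifier serves as test function; the sign from differentiating `x - y` in `y`
  -- cancels the one in the definition of a weak derivative.
  set χ : Rd d → ℝ := fun y => φ.normed volume (x - y) with hχ
  have hχt : IsTestFunction univ χ := by
    refine ⟨hφs.comp (contDiff_const.sub contDiff_id), ?_, subset_univ _⟩
    exact φ.hasCompactSupport_normed.comp_homeomorph (Homeomorph.subLeft x)
  have hχd : ∀ y, partialDeriv k χ y
      = - fderiv ℝ (φ.normed volume) (x - y) (EuclideanSpace.single k 1) := fun y => by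
    have h1 : HasFDerivAt (fun y : Rd d => x - y) (-ContinuousLinearMap.id ℝ (Rd d)) y := by
      simpa using (hasFDerivAt_id (𝕜 := ℝ) y).const_sub x
    have h2 := (hφs.differentiable (by simp) (x - y)).hasFDerivAt.comp y h1
    have h3 : HasFDerivAt χ _ y := h2
    simp [partialDeriv, h3.fderiv]
  have hw := h.2.2 χ hχt
  simp only [Measure.restrict_univ, hχd] at hw
  rw [partialDeriv, mollify, hd.fderiv, mollify_apply_swap, convolution_eq_swap,
    ContinuousLinearMap.integral_apply hex.integrable_swap]
  have e1 : ∫ y, g y * χ y = ∫ y, φ.normed volume (x - y) * g y :=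
    integral_congr_ae (Eventually.of_forall fun y => mul_comm _ _)
  rw [e1] at hw
  simp only [mul_neg, integral_neg, neg_inj] at hw
  rw [← hw]
  refine integral_congr_ae (Eventually.of_forall fun y => ?_)
  simp [mul_comm]

/-! ### Products of test functions and Sobolev functions -/

lemma MemLpLoc.mul_testFunction {Ω : Set (Rd d)} {u σ : Rd d → ℝ} (hu : MemLpLoc 2 Ω u)
    (hσ : IsTestFunction Ω σ) : MemLp (fun x => u x * σ x) 2 := by
  have h1 := hu _ hσ.2.1 hσ.2.2
  obtain ⟨C, hC⟩ := hσ.2.1.exists_bound_of_continuousOn hσ.continuous.continuousOn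
  have h2 : MemLp (fun x => u x * σ x) 2 (volume.restrict (tsupport σ)) := by
    refine (h1.const_mul C).of_le (h1.1.mul hσ.continuous.aestronglyMeasurable) ?_
    refine (ae_restrict_mem (isClosed_tsupport σ).measurableSet).mono fun x hx => ?_
    rw [norm_mul, norm_mul, mul_comm]
    gcongr
    exact (hC x hx).trans (le_abs_self C)
  rw [← memLp_indicator_iff_restrict (isClosed_tsupport σ).measurableSet] at h2
  rwa [indicator_eq_self.2 ((Function.support_mul_subset_right u σ).trans
    (subset_tsupport σ))] at h2

lemma MemW1pLoc.memLpLoc_weakPartial {p : ℝ≥0∞} {Ω : Set (Rd d)} {u : Rd d → ℝ} (hΩ : IsOpen Ω)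
    (hu : MemW1pLoc p Ω u) (k : Fin d) :
    HasWeakPartial Ω k u (weakPartial Ω k u) ∧ MemLpLoc p Ω (weakPartial Ω k u) := by
  obtain ⟨g, hg, hgp⟩ := hu.2 k
  refine ⟨hg.weakPartial_spec, fun K hK hKΩ => ?_⟩
  exact (memLp_congr_ae (ae_restrict_of_ae_restrict_of_subset hKΩ (hg.weakPartial_ae_eq hΩ))).2
    (hgp K hK hKΩ)

/-- The filter form allows one radius to serve a function and all its partial derivatives
simultaneously. -/
lemma eventually_eLpNorm_mollify_sub_le {f : Rd d → ℝ} (hf : MemLp f 2) {ε : ℝ≥0∞} (hε : ε ≠ 0) :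
    ∀ᶠ r in 𝓝[>] (0 : ℝ), ∀ φ : ContDiffBump (0 : Rd d), φ.rOut = r →
      eLpNorm (mollify φ f - f) 2 ≤ ε := by
  obtain ⟨δ, hδ, h⟩ := exists_eLpNorm_mollify_sub_le hf hε
  filter_upwards [Ioo_mem_nhdsGT hδ] with r hr φ hφ
  exact h φ (hφ ▸ hr.2)

section form

variable {Ω : Set (Rd d)} {c : Rd d → Matrix (Fin d) (Fin d) ℝ}

/-- Compactly supported weakly differentiable functions belong to `D(h_D)`. -/
lemma memFormD_of_hasWeakPartial (hΩ : IsOpen Ω) (hpos : ∀ x ∈ Ω, (c x).PosDef)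
    (hcont : ∀ k l, ContinuousOn (fun x => c x k l) Ω) {f : Rd d → ℝ} {g : Fin d → Rd d → ℝ}
    (hf : MemLp f 2) (hg : ∀ k, MemLp (g k) 2) (hfg : ∀ k, HasWeakPartial univ k f (g k))
    (hsupp : HasCompactSupport f) (hsub : tsupport f ⊆ Ω) : MemFormD Ω c f := by
  obtain ⟨δ, hδ, hδΩ⟩ := hsupp.isCompact.exists_cthickening_subset_open hΩ hsub
  have hK : IsCompact (Metric.cthickening δ (tsupport f)) := hsupp.isCompact.cthickening
  set K := Metric.cthickening δ (tsupport f)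
  obtain ⟨M, hM0, hM⟩ := exists_quad_le hcont hK hδΩ
  have hex : ∀ n : ℕ, ∃ φ : ContDiffBump (0 : Rd d), φ.rOut ≤ δ ∧
      eLpNorm (mollify φ f - f) 2 ≤ (n + 1 : ℝ≥0∞)⁻¹ ∧
      ∀ k, eLpNorm (mollify φ (g k) - g k) 2 ≤ (n + 1 : ℝ≥0∞)⁻¹ := fun n => by
    have hn : (n + 1 : ℝ≥0∞)⁻¹ ≠ 0 := by simp
    obtain ⟨r, ⟨h1, h2⟩, h3, h4⟩ := (((eventually_eLpNorm_mollify_sub_le hf hn).and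
      (eventually_all.2 fun k => eventually_eLpNorm_mollify_sub_le (hg k) hn)).and
      (Ioo_mem_nhdsGT hδ)).exists
    exact ⟨⟨r / 2, r, by linarith, by linarith⟩, h4.le, h1 _ rfl, fun k => h2 k _ rfl⟩
  choose φ hφδ hφf hφg using hex
  have hfl : LocallyIntegrable f := hf.locallyIntegrable (by simp)
  have hsK : ∀ n, Function.support (mollify (φ n) f) ⊆ K := fun n =>
    (support_mollify_subset _ f).trans (Metric.cthickening_mono (hφδ n) _)
  have htK : ∀ n, tsupport (mollify (φ n) f) ⊆ K := fun n => closure_minimal (hsK n) hK.isClosed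
  have htest : ∀ n, IsTestFunction Ω (mollify (φ n) f) := fun n =>
    ⟨contDiff_mollify _ hfl, HasCompactSupport.of_support_subset_isCompact hK (hsK n),
      (htK n).trans hδΩ⟩
  have hlim : Tendsto (fun n : ℕ => (n + 1 : ℝ≥0∞)⁻¹) atTop (𝓝 0) := by
    have h := (tendsto_add_atTop_iff_nat 1).2 ENNReal.tendsto_inv_nat_nhds_zero
    simpa using h
  refine ⟨hf.restrict Ω, fun n => mollify (φ n) f, htest, ?_, ?_⟩
  · refine tendsto_of_tendsto_of_tendsto_of_le_of_le tendsto_const_nhds hlim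
      (fun n => zero_le) fun n => ?_
    exact (eLpNorm_mono_measure _ Measure.restrict_le_self).trans (hφf n)
  -- Derivatives of the mollifications are mollifications of the `g k`, hence L₂-Cauchy; the
  -- coefficients are bounded on `K`, and off `K` the gradients vanish.
  have hbound : ∀ p q : ℕ, ENNReal.ofReal (form Ω c (mollify (φ p) f - mollify (φ q) f)) ≤
      ENNReal.ofReal M * ∑ _k : Fin d, ((p + 1 : ℝ≥0∞)⁻¹ + (q + 1 : ℝ≥0∞)⁻¹) ^ 2 := fun p q => by
    have ht := (htest p).sub (htest q)
    rw [ofReal_form hΩ hpos hcont ht]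
    have h1 : ∀ x, ENNReal.ofReal (quad c x (grad (mollify (φ p) f - mollify (φ q) f) x)) ≤
        ENNReal.ofReal M *
          ∑ k, ENNReal.ofReal ((mollify (φ p) (g k) - mollify (φ q) (g k)) x ^ 2) := fun x => by
      have hgr : ∀ k, grad (mollify (φ p) f - mollify (φ q) f) x k
          = (mollify (φ p) (g k) - mollify (φ q) (g k)) x := fun k => by
        rw [grad_sub (htest p).differentiable (htest q).differentiable]
        simp only [Pi.sub_apply, grad, partialDeriv_mollify _ (hfg k)]
      by_cases hx : x ∈ K
      · refine (ENNReal.ofReal_le_ofReal (hM x hx _)).trans_eq ?_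
        rw [ENNReal.ofReal_mul hM0, ENNReal.ofReal_sum_of_nonneg fun k _ => sq_nonneg _]
        simp only [hgr]
      · have h0 : grad (mollify (φ p) f - mollify (φ q) f) x = 0 := by
          ext k
          by_contra hne
          exact hx (((support_partialDeriv_subset _ k).trans ((tsupport_sub _ _).trans
            (union_subset (htK p) (htK q)))) hne)
        rw [h0]
        simp [quad]
    have hms : ∀ n k, AEStronglyMeasurable (mollify (φ n) (g k)) volume := fun n k =>
      (contDiff_mollify _ ((hg k).locallyIntegrable (by simp))).continuous.aestronglyMeasurable
    refine (lintegral_mono h1).trans ?_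
    rw [lintegral_const_mul' _ _ ENNReal.ofReal_ne_top, lintegral_finsetSum']
    · gcongr with k
      rw [← eLpNorm_two_sq]
      gcongr
      refine (eLpNorm_mono_measure _ Measure.restrict_le_self).trans ?_
      have e : mollify (φ p) (g k) - mollify (φ q) (g k)
          = (mollify (φ p) (g k) - g k) - (mollify (φ q) (g k) - g k) := by abel
      rw [e]
      exact (eLpNorm_sub_le ((hms p k).sub (hg k).1) ((hms q k).sub (hg k).1) (by simp)).trans
        (add_le_add (hφg p k) (hφg q k))
    · intro k _
      exact (((hms p k).sub (hms q k)).aemeasurable.pow_const 2).ennreal_ofReal.restrict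
  have hlim2 : Tendsto (fun p : ℕ × ℕ => ENNReal.ofReal M *
      ∑ _k : Fin d, ((p.1 + 1 : ℝ≥0∞)⁻¹ + (p.2 + 1 : ℝ≥0∞)⁻¹) ^ 2) atTop (𝓝 0) := by
    rw [← prod_atTop_atTop_eq]
    have h1 : Tendsto (fun p : ℕ × ℕ => (p.1 + 1 : ℝ≥0∞)⁻¹ + (p.2 + 1 : ℝ≥0∞)⁻¹)
        (atTop ×ˢ atTop) (𝓝 (0 + 0)) :=
      (hlim.comp tendsto_fst).add (hlim.comp tendsto_snd)
    have h2 := (ENNReal.continuous_pow 2).continuousAt.tendsto.comp h1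
    have h3 := ENNReal.Tendsto.const_mul (a := ENNReal.ofReal M)
      (tendsto_finsetSum (Finset.univ : Finset (Fin d)) fun _ _ => h2)
      (Or.inr ENNReal.ofReal_ne_top)
    simpa using h3
  have h3 : Tendsto (fun p : ℕ × ℕ =>
      ENNReal.ofReal (form Ω c (mollify (φ p.1) f - mollify (φ p.2) f))) atTop (𝓝 0) :=
    tendsto_of_tendsto_of_tendsto_of_le_of_le tendsto_const_nhds hlim2
      (fun _ => zero_le) fun p => hbound p.1 p.2
  have h4 := (ENNReal.tendsto_toReal ENNReal.zero_ne_top).comp h3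
  simp only [ENNReal.toReal_zero] at h4
  refine h4.congr fun p => ?_
  exact ENNReal.toReal_ofReal (form_nonneg hΩ hpos hcont ((htest p.1).sub (htest p.2)))

lemma memFormD_testFunction_mul (hΩ : IsOpen Ω) (hpos : ∀ x ∈ Ω, (c x).PosDef)
    (hcont : ∀ k l, ContinuousOn (fun x => c x k l) Ω) {u σ : Rd d → ℝ} (hu : MemW1pLoc 2 Ω u)
    (hσ : IsTestFunction Ω σ) : MemFormD Ω c (fun x => σ x * u x) := by
  have hw := hu.memLpLoc_weakPartial hΩ
  refine memFormD_of_hasWeakPartial hΩ hpos hcont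
    (g := fun k x => σ x * weakPartial Ω k u x + u x * partialDeriv k σ x) ?_ (fun k => ?_)
    (fun k => (hw k).1.testFunction_mul hσ) hσ.2.1.mul_right
    ((tsupport_mul_subset_left (f := σ) (g := u)).trans hσ.2.2)
  · simpa only [mul_comm] using hu.1.mul_testFunction hσ
  · refine MemLp.add ?_ (hu.1.mul_testFunction (hσ.partialDeriv k))
    simpa only [mul_comm] using (hw k).2.mul_testFunction hσ

end form

/-! ### Closability of the form -/

lemma tendsto_zero_of_tendsto_sq {ι : Type*} {l : Filter ι} {a : ι → ℝ≥0∞}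
    (h : Tendsto (fun n => a n ^ 2) l (𝓝 0)) : Tendsto a l (𝓝 0) := by
  have h2 := (ENNReal.continuous_rpow_const (y := (1 / 2 : ℝ))).continuousAt.tendsto.comp h
  simp only [Function.comp_def] at h2
  rw [ENNReal.zero_rpow_of_pos (by norm_num)] at h2
  refine h2.congr fun n => ?_
  rw [← ENNReal.rpow_natCast, ← ENNReal.rpow_mul]
  simp

lemma MemLpLoc.locallyIntegrableOn {Ω : Set (Rd d)} (hΩ : IsOpen Ω) {f : Rd d → ℝ}
    (hf : MemLpLoc 2 Ω f) : LocallyIntegrableOn f Ω := by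
  rw [locallyIntegrableOn_iff hΩ.isLocallyClosed]
  intro K hKΩ hK
  have : IsFiniteMeasure (volume.restrict K) := isFiniteMeasure_restrict.2 hK.measure_lt_top.ne
  exact (hf K hK hKΩ).integrable (by simp)

/-- Cauchy–Schwarz turns L₂ convergence into L₁ convergence of the products. It serves to pass to
the limit in the weak derivative identity. -/
lemma tendsto_integral_mul_of_tendsto_eLpNorm {α : Type*} {m : MeasurableSpace α} {μ : Measure α}
    {F : ℕ → α → ℝ} {f v : α → ℝ} (hF : ∀ n, MemLp (F n) 2 μ) (hf : MemLp f 2 μ)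
    (hv : MemLp v 2 μ) (h : Tendsto (fun n => eLpNorm (F n - f) 2 μ) atTop (𝓝 0)) :
    Tendsto (fun n => ∫ x, F n x * v x ∂μ) atTop (𝓝 (∫ x, f x * v x ∂μ)) := by
  have hFi : ∀ n, Integrable (fun x => F n x * v x) μ := fun n => (hF n).integrable_mul hv
  refine tendsto_integral_of_L1' _ (hf.integrable_mul hv).1 (Eventually.of_forall hFi) ?_
  have h0 : Tendsto (fun n => eLpNorm (F n - f) 2 μ * eLpNorm v 2 μ) atTop (𝓝 0) := by
    simpa using ENNReal.Tendsto.mul_const h (Or.inr hv.eLpNorm_ne_top)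
  refine tendsto_of_tendsto_of_tendsto_of_le_of_le tendsto_const_nhds h0 (fun n => zero_le)
    fun n => ?_
  have e : (fun x => F n x * v x) - (f * v) = (F n - f) • v := by
    ext x
    simp [sub_mul]
  change eLpNorm ((fun x => F n x * v x) - (f * v)) 1 μ ≤ _
  rw [e]
  exact eLpNorm_smul_le_mul_eLpNorm hv.1 ((hF n).1.sub hf.1)

section form

variable {Ω : Set (Rd d)} {c : Rd d → Matrix (Fin d) (Fin d) ℝ}

/-- The form controls the `L₂`-norm of the gradient on compact subsets. -/
lemma exists_eLpNorm_sq_le (hpos : ∀ x ∈ Ω, (c x).PosDef)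
    (hcont : ∀ k l, ContinuousOn (fun x => c x k l) Ω) {K : Set (Rd d)} (hK : IsCompact K)
    (hKΩ : K ⊆ Ω) : ∃ C : ℝ, 0 < C ∧ ∀ (v : Rd d → Fin d → ℝ) (k : Fin d),
      eLpNorm (fun x => v x k) 2 (volume.restrict K) ^ 2
        ≤ ENNReal.ofReal C ^ 2 * ∫⁻ x in Ω, ENNReal.ofReal (quad c x (v x)) := by
  obtain ⟨κ, hκ, h⟩ := exists_quad_ge hpos hcont hK hKΩ
  -- The constant enters squared so that square roots can be taken later; its square is the inverse
  -- of the ellipticity constant.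
  refine ⟨√κ⁻¹, by positivity, fun v k => ?_⟩
  rw [← ENNReal.ofReal_pow (by positivity), Real.sq_sqrt (by positivity), eLpNorm_two_sq,
    ← lintegral_const_mul' _ _ ENNReal.ofReal_ne_top]
  refine le_trans ?_ (lintegral_mono_set hKΩ)
  refine setLIntegral_mono' hK.measurableSet fun x hx => ?_
  rw [← ENNReal.ofReal_mul (by positivity)]
  refine ENNReal.ofReal_le_ofReal ?_
  rw [inv_mul_eq_div, le_div_iff₀ hκ, mul_comm]
  exact h x hx (v x) k

/-- Elements of `D(h_D)` are weakly differentiable, and approximated by test functions in the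
form norm. -/
lemma MemFormD.exists_approx (hΩ : IsOpen Ω) (hpos : ∀ x ∈ Ω, (c x).PosDef)
    (hcont : ∀ k l, ContinuousOn (fun x => c x k l) Ω) {η : Rd d → ℝ} (hη : MemFormD Ω c η) :
    ∃ χ : ℕ → Rd d → ℝ, (∀ n, IsTestFunction Ω (χ n)) ∧
      Tendsto (fun n => eLpNorm (χ n - η) 2 (volume.restrict Ω)) atTop (𝓝 0) ∧
      Tendsto (fun n => ∫⁻ x in Ω, ENNReal.ofReal (quad c x (grad (χ n) x - weakGrad Ω η x)))
        atTop (𝓝 0) := by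
  obtain ⟨hη2, χ₀, hχ₀, hlim₀, hC₀⟩ := hη
  -- Energies of differences below 4⁻ᴺ bound L₂ norms of gradient differences on compact sets by a
  -- multiple of 2⁻ᴺ. These are summable, so a subsequence has gradients converging almost
  -- everywhere.
  have hEC : ∀ N : ℕ, ∀ᶠ k : ℕ in atTop, ∀ p ≥ k, ∀ q ≥ k,
      ∫⁻ x in Ω, ENNReal.ofReal (quad c x (grad (χ₀ p) x - grad (χ₀ q) x))
        < ((1 / 2 : ℝ≥0∞) ^ N) ^ 2 := fun N => by
    have h1 : Tendsto (fun p : ℕ × ℕ => ENNReal.ofReal (form Ω c (χ₀ p.1 - χ₀ p.2)))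
        atTop (𝓝 0) := by simpa using ENNReal.tendsto_ofReal hC₀
    have h0 : (0 : ℝ≥0∞) < ((1 / 2 : ℝ≥0∞) ^ N) ^ 2 := pos_iff_ne_zero.2 (by simp)
    have h2 := h1.eventually_lt_const h0
    obtain ⟨⟨a, b⟩, hab⟩ := eventually_atTop.1 h2
    filter_upwards [eventually_ge_atTop (max a b)] with k hk p hp q hq
    have h3 := hab (p, q) ⟨(le_max_left a b).trans (hk.trans hp),
      (le_max_right a b).trans (hk.trans hq)⟩
    rw [ofReal_form hΩ hpos hcont ((hχ₀ p).sub (hχ₀ q))] at h3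
    simpa only [grad_sub (hχ₀ p).differentiable (hχ₀ q).differentiable] using h3
  obtain ⟨s, hs, hsE⟩ := extraction_forall_of_eventually hEC
  set χ : ℕ → Rd d → ℝ := fun n => χ₀ (s n) with hχdef
  have hχ : ∀ n, IsTestFunction Ω (χ n) := fun n => hχ₀ _
  have hlim : Tendsto (fun n => eLpNorm (χ n - η) 2 (volume.restrict Ω)) atTop (𝓝 0) :=
    hlim₀.comp hs.tendsto_atTop
  have hE : ∀ N p q, N ≤ p → N ≤ q →
      ∫⁻ x in Ω, ENNReal.ofReal (quad c x (grad (χ p) x - grad (χ q) x))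
        < ((1 / 2 : ℝ≥0∞) ^ N) ^ 2 := fun N p q hp hq =>
    hsE N _ (hs.monotone hp) _ (hs.monotone hq)
  -- almost everywhere convergence of the gradients
  have hconvK : ∀ K : Set (Rd d), IsCompact K → K ⊆ Ω → ∀ k, ∀ᵐ x ∂(volume.restrict K),
      ∃ l, Tendsto (fun n => grad (χ n) x k) atTop (𝓝 l) := fun K hK hKΩ k => by
    obtain ⟨C, hC, hle⟩ := exists_eLpNorm_sq_le hpos hcont hK hKΩ
    refine Lp.ae_tendsto_of_cauchy_eLpNorm (p := 2) (f := fun n x => grad (χ n) x k)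
      (B := fun N => ENNReal.ofReal C * (1 / 2) ^ N)
      (fun n => aestronglyMeasurable_grad (hχ n).1 k _) (by simp) ?_ fun N n m hn hm => ?_
    · rw [ENNReal.tsum_mul_left]
      simp only [one_div, ENNReal.tsum_geometric_two]
      exact ENNReal.mul_ne_top ENNReal.ofReal_ne_top (by simp)
    · rw [← ENNReal.pow_lt_pow_left_iff two_ne_zero, mul_pow]
      refine (hle (fun x => grad (χ n) x - grad (χ m) x) k).trans_lt ?_
      have hC0 : ENNReal.ofReal C ^ 2 ≠ 0 := by simp [hC]
      exact (ENNReal.mul_lt_mul_iff_right hC0 (by simp)).2 (hE N n m hn hm)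
  have hconv : ∀ᵐ x ∂(volume.restrict Ω), ∀ k, ∃ l,
      Tendsto (fun n => grad (χ n) x k) atTop (𝓝 l) := by
    rw [ae_all_iff]
    intro k
    -- Ellipticity is only uniform on compact sets, so convergence is obtained on each member of a
    -- countable compact cover.
    have hσ : IsSigmaCompact Ω := by
      have := hΩ.locallyCompactSpace
      exact isSigmaCompact_iff_sigmaCompactSpace.2 inferInstance
    obtain ⟨K, hK, hKΩ⟩ := hσ
    rw [← hKΩ, ae_restrict_iUnion_iff]
    exact fun j => hconvK _ (hK j) (hKΩ ▸ subset_iUnion K j) k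
  set g : Rd d → Fin d → ℝ := fun x k => limUnder atTop fun n => grad (χ n) x k with hgdef
  have hg : ∀ᵐ x ∂(volume.restrict Ω), ∀ k, Tendsto (fun n => grad (χ n) x k) atTop (𝓝 (g x k)) :=
    hconv.mono fun x hx k => tendsto_nhds_limUnder (hx k)
  have hgm : ∀ k, AEStronglyMeasurable (fun x => g x k) (volume.restrict Ω) := fun k =>
    aestronglyMeasurable_of_tendsto_ae atTop
      (fun n => aestronglyMeasurable_grad (hχ n).1 k _) (hg.mono fun x hx => hx k)
  -- Fatou
  have hFatou : ∀ m, ∫⁻ x in Ω, ENNReal.ofReal (quad c x (grad (χ m) x - g x))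
      ≤ ((1 / 2 : ℝ≥0∞) ^ m) ^ 2 := fun m => by
    have h1 : ∀ᵐ x ∂(volume.restrict Ω), ENNReal.ofReal (quad c x (grad (χ m) x - g x)) =
        liminf (fun n => ENNReal.ofReal (quad c x (grad (χ m) x - grad (χ n) x))) atTop := by
      filter_upwards [hg] with x hx
      have h2 : Tendsto (fun n => grad (χ m) x - grad (χ n) x) atTop
          (𝓝 (grad (χ m) x - g x)) := tendsto_const_nhds.sub (tendsto_pi_nhds.2 hx)
      exact (ENNReal.tendsto_ofReal
        (((continuous_quad_apply x).tendsto _).comp h2)).liminf_eq.symm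
    rw [lintegral_congr_ae h1]
    refine (lintegral_liminf_le' fun n => ?_).trans ?_
    · exact (aestronglyMeasurable_quad hΩ hcont fun k =>
        (aestronglyMeasurable_grad (hχ m).1 k _).sub
          (aestronglyMeasurable_grad (hχ n).1 k _)).aemeasurable.ennreal_ofReal
    · refine (liminf_le_liminf (v := fun _ => ((1 / 2 : ℝ≥0∞) ^ m) ^ 2) ?_).trans_eq
        (liminf_const _)
      filter_upwards [eventually_ge_atTop m] with n hn
      exact (hE m m n le_rfl hn).le
  have hpow : Tendsto (fun m : ℕ => ((1 / 2 : ℝ≥0∞) ^ m) ^ 2) atTop (𝓝 0) := by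
    have h1 := ENNReal.tendsto_pow_atTop_nhds_zero_of_lt_one (r := 1 / 2) (by simp)
    have h2 := (ENNReal.continuous_pow 2).continuousAt.tendsto.comp h1
    simpa [Function.comp_def] using h2
  have hFlim : Tendsto (fun m => ∫⁻ x in Ω, ENNReal.ofReal (quad c x (grad (χ m) x - g x)))
      atTop (𝓝 0) :=
    tendsto_of_tendsto_of_tendsto_of_le_of_le tendsto_const_nhds hpow (fun n => zero_le) hFatou
  -- convergence in `L₂` on compact sets
  have hgK : ∀ K : Set (Rd d), IsCompact K → K ⊆ Ω → ∀ k,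
      MemLp (fun x => g x k) 2 (volume.restrict K) ∧
      Tendsto (fun n => eLpNorm (fun x => grad (χ n) x k - g x k) 2 (volume.restrict K))
        atTop (𝓝 0) := fun K hK hKΩ k => by
    obtain ⟨C, hC, hle⟩ := exists_eLpNorm_sq_le hpos hcont hK hKΩ
    have hle' := fun n => hle (fun x => grad (χ n) x - g x) k
    have hgmK : AEStronglyMeasurable (fun x => g x k) (volume.restrict K) :=
      (hgm k).mono_measure (Measure.restrict_mono hKΩ le_rfl)
    constructor
    · have h1 : MemLp (fun x => grad (χ 0) x k - g x k) 2 (volume.restrict K) := by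
        refine ⟨(aestronglyMeasurable_grad (hχ 0).1 k _).sub hgmK, ?_⟩
        have h2 : eLpNorm (fun x => grad (χ 0) x k - g x k) 2 (volume.restrict K) ^ 2 < ⊤ :=
          (hle' 0).trans_lt (ENNReal.mul_lt_top (by simp) ((hFatou 0).trans_lt (by simp)))
        exact (ENNReal.pow_lt_top_iff.1 h2).resolve_right two_ne_zero
      have h3 : MemLp (fun x => grad (χ 0) x k) 2 (volume.restrict K) :=
        ((hχ 0).partialDeriv k).memLp_two.restrict K
      have h4 := h3.sub h1
      have e : (fun x => grad (χ 0) x k) - (fun x => grad (χ 0) x k - g x k)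
          = fun x => g x k := by
        ext x
        simp
      rwa [e] at h4
    · have h1 : Tendsto (fun n =>
          eLpNorm (fun x => grad (χ n) x k - g x k) 2 (volume.restrict K) ^ 2) atTop (𝓝 0) := by
        refine tendsto_of_tendsto_of_tendsto_of_le_of_le tendsto_const_nhds ?_
          (fun n => zero_le) hle'
        simpa using ENNReal.Tendsto.const_mul (a := ENNReal.ofReal C ^ 2) hFlim
          (Or.inr (by simp))
      exact tendsto_zero_of_tendsto_sq h1
  -- Integration by parts for `χ n` passes to the limit: the function converges in L₂(Ω), the
  -- gradient in L₂ on the compact support of the test function. Hence `g` is the weak gradient of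
  -- `η`.
  have hweak : ∀ k, HasWeakPartial Ω k η (fun x => g x k) := fun k => by
    refine ⟨locallyIntegrableOn_of_locallyIntegrable_restrict
      (hη2.locallyIntegrable (by simp)),
      MemLpLoc.locallyIntegrableOn hΩ fun K hK hKΩ => (hgK K hK hKΩ k).1, fun ψ hψ => ?_⟩
    · have h1 : Tendsto (fun n => ∫ x in Ω, χ n x * partialDeriv k ψ x) atTop
          (𝓝 (∫ x in Ω, η x * partialDeriv k ψ x)) :=
        tendsto_integral_mul_of_tendsto_eLpNorm (fun n => (hχ n).memLp_two.restrict Ω) hη2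
          ((hψ.partialDeriv k).memLp_two.restrict Ω) hlim
      obtain ⟨h2, h3⟩ := hgK _ hψ.2.1 hψ.2.2 k
      have h7 : ∀ n, MemLp (fun x => grad (χ n) x k) 2 (volume.restrict (tsupport ψ)) :=
        fun n => ((hχ n).partialDeriv k).memLp_two.restrict _
      have h4 : Tendsto (fun n => ∫ x in tsupport ψ, grad (χ n) x k * ψ x) atTop
          (𝓝 (∫ x in tsupport ψ, g x k * ψ x)) :=
        tendsto_integral_mul_of_tendsto_eLpNorm h7 h2 (hψ.memLp_two.restrict _) h3
      have h5 : ∀ f : Rd d → ℝ, ∫ x in tsupport ψ, f x * ψ x = ∫ x in Ω, f x * ψ x := fun f => by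
        rw [hψ.setIntegral_mul_eq]
        exact setIntegral_eq_integral_of_forall_compl_eq_zero fun x hx => by
          rw [image_eq_zero_of_notMem_tsupport hx, mul_zero]
      simp only [h5] at h4
      have h6 : ∀ n, ∫ x in Ω, χ n x * partialDeriv k ψ x = -∫ x in Ω, grad (χ n) x k * ψ x :=
        fun n => (HasWeakPartial.of_contDiff (hχ n).1 k).2.2 ψ hψ
      simp only [h6] at h1
      exact tendsto_nhds_unique h1 h4.neg
  refine ⟨χ, hχ, hlim, hFlim.congr fun n => lintegral_congr_ae ?_⟩
  filter_upwards [ae_all_iff.2 fun k => (hweak k).weakPartial_ae_eq hΩ] with x hx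
  have e : weakGrad Ω η x = g x := funext hx
  rw [e]

end form

/-! ### Zero capacity of the boundary implies the condition `𝒞_A` -/

/-- No differentiability is required, because the default value of `weakPartial` is 0. -/
lemma aestronglyMeasurable_weakPartial (Ω : Set (Rd d)) (k : Fin d) (f : Rd d → ℝ) :
    AEStronglyMeasurable (weakPartial Ω k f) (volume.restrict Ω) := by
  by_cases h : ∃ g, HasWeakPartial Ω k f g
  · exact h.choose_spec.weakPartial_spec.2.1.aestronglyMeasurable
  · rw [weakPartial, dif_neg h]
    exact aestronglyMeasurable_zero

section form

variable {Ω : Set (Rd d)} {c : Rd d → Matrix (Fin d) (Fin d) ℝ}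

lemma MemW1pLoc.one_sub {u : Rd d → ℝ} (hu : MemW1pLoc 2 Ω u) :
    MemW1pLoc 2 Ω (fun x => 1 - u x) := by
  refine ⟨fun K hK hKΩ => ?_, fun k => ?_⟩
  · have : IsFiniteMeasure (volume.restrict K) := isFiniteMeasure_restrict.2 hK.measure_lt_top.ne
    exact (memLp_const 1).sub (hu.1 K hK hKΩ)
  · obtain ⟨g, hg, hg2⟩ := hu.2 k
    exact ⟨_, hg.one_sub, fun K hK hKΩ => (hg2 K hK hKΩ).neg⟩

/-- Membership gives integrability of Γ(ψ) + ψ² only. Both terms are nonnegative, so each is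
integrable by domination, and neither Bochner integral in `graphNormSq` is a default 0. -/
lemma MemFormN.lintegral_le (hΩ : IsOpen Ω) (hpos : ∀ x ∈ Ω, (c x).PosDef)
    (hcont : ∀ k l, ContinuousOn (fun x => c x k l) Ω) {ψ : Rd d → ℝ} (hψ : MemFormN Ω c ψ) :
    ∫⁻ x in Ω, ENNReal.ofReal (quad c x (weakGrad Ω ψ x)) ≤ ENNReal.ofReal (graphNormSq Ω c ψ) ∧
      eLpNorm ψ 2 (volume.restrict Ω) ^ 2 ≤ ENNReal.ofReal (graphNormSq Ω c ψ) := by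
  have hm1 := aestronglyMeasurable_quad (c := c) hΩ hcont (v := weakGrad Ω ψ)
    fun k => aestronglyMeasurable_weakPartial Ω k ψ
  have hm2 : AEStronglyMeasurable (fun x => ψ x ^ 2) (volume.restrict Ω) :=
    (hψ.1.1.locallyIntegrableOn hΩ).aestronglyMeasurable.pow 2
  have hn : ∀ᵐ x ∂(volume.restrict Ω), 0 ≤ quad c x (weakGrad Ω ψ x) :=
    (ae_restrict_mem hΩ.measurableSet).mono fun x hx => quad_nonneg hpos hx _
  have hi1 : IntegrableOn (fun x => quad c x (weakGrad Ω ψ x)) Ω := by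
    refine Integrable.mono' hψ.2 hm1 (hn.mono fun x hx => ?_)
    rw [Real.norm_of_nonneg hx, carreDuChamp_eq_quad]
    exact le_add_of_nonneg_right (sq_nonneg _)
  have hi2 : IntegrableOn (fun x => ψ x ^ 2) Ω := by
    refine Integrable.mono' hψ.2 hm2 (hn.mono fun x hx => ?_)
    rw [Real.norm_of_nonneg (sq_nonneg _), carreDuChamp_eq_quad]
    exact le_add_of_nonneg_left hx
  have h1 : 0 ≤ formN Ω c ψ := integral_nonneg_of_ae hn
  have h2 : 0 ≤ ∫ x in Ω, ψ x ^ 2 := integral_nonneg fun x => sq_nonneg _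
  rw [eLpNorm_two_sq, ← ofReal_integral_eq_lintegral_ofReal hi1 hn,
    ← ofReal_integral_eq_lintegral_ofReal hi2 (Eventually.of_forall fun x => sq_nonneg _)]
  exact ⟨ENNReal.ofReal_le_ofReal (le_add_of_nonneg_right h2),
    ENNReal.ofReal_le_ofReal (le_add_of_nonneg_left h1)⟩

/-- Cutting off `1 - ψ`, where `ψ = 1` near the boundary of `Ω`. -/
lemma exists_memFormD_of_eq_one_near_frontier (hΩ : IsOpen Ω) (hpos : ∀ x ∈ Ω, (c x).PosDef)
    (hcont : ∀ k l, ContinuousOn (fun x => c x k l) Ω) {A U : Set (Rd d)}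
    (hA : Bornology.IsBounded A) (hU : IsOpen U) (hfU : frontier Ω ⊆ U) {ψ : Rd d → ℝ}
    (hψ : MemW1pLoc 2 Ω ψ) (hψU : ∀ᵐ x ∂(volume.restrict (U ∩ Ω)), ψ x = 1) :
    ∃ η : Rd d → ℝ, MemFormD Ω c η ∧ ∀ᵐ x ∂(volume.restrict (closure A ∩ Ω)),
      1 - η x = ψ x ∧ quad c x (weakGrad Ω η x) ≤ quad c x (weakGrad Ω ψ x) := by
  -- The set on which σ has to be 1: what remains of `closure A ∩ closure Ω` away from the
  -- neighbourhood `U` of the boundary.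
  have hK : IsCompact (closure A ∩ (closure Ω \ U)) :=
    hA.isCompact_closure.inter_right (isClosed_closure.sdiff hU)
  have hKΩ : closure A ∩ (closure Ω \ U) ⊆ Ω := fun x hx => by
    by_contra h
    exact hx.2.2 (hfU (by rw [hΩ.frontier_eq]; exact ⟨hx.2.1, h⟩))
  obtain ⟨σ, hσ, hσ01, hσ1⟩ := exists_isTestFunction_one_nhds hΩ hK hKΩ
  have hm : MeasurableSet (closure A ∩ Ω) := isClosed_closure.measurableSet.inter hΩ.measurableSet
  have hgrad : ∀ᵐ x ∂(volume.restrict Ω), ∀ k, weakPartial Ω k (fun x => σ x * (1 - ψ x)) x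
      = σ x * -weakPartial Ω k ψ x + (1 - ψ x) * partialDeriv k σ x :=
    ae_all_iff.2 fun k => (((hψ.memLpLoc_weakPartial hΩ k).1.one_sub.testFunction_mul hσ).mono
      (subset_univ Ω)).weakPartial_ae_eq hΩ
  refine ⟨fun x => σ x * (1 - ψ x), memFormD_testFunction_mul hΩ hpos hcont hψ.one_sub hσ, ?_⟩
  rw [ae_restrict_iff' (hU.inter hΩ).measurableSet] at hψU
  rw [ae_restrict_iff' hΩ.measurableSet] at hgrad
  rw [ae_restrict_iff' hm]
  filter_upwards [hψU, hgrad] with x h1 h2 hx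
  have h2' := h2 hx.2
  by_cases hxU : x ∈ U
  · have h3 := h1 ⟨hxU, hx.2⟩
    refine ⟨by simp [h3], ?_⟩
    have e : weakGrad Ω (fun x => σ x * (1 - ψ x)) x = (-σ x) • weakGrad Ω ψ x := by
      ext k
      simp only [weakGrad, h2' k, h3, Pi.smul_apply, smul_eq_mul]
      ring
    rw [e, quad_smul, neg_sq]
    refine mul_le_of_le_one_left (quad_nonneg hpos hx.2 _) ?_
    exact pow_le_one₀ (hσ01 x).1 (hσ01 x).2
  · have h4 := hσ1 x ⟨hx.1, subset_closure hx.2, hxU⟩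
    have h5 : ∀ k, partialDeriv k σ x = 0 := fun k => by
      rw [partialDeriv_congr (g := fun _ => 1) h4 k]
      simp [partialDeriv]
    have h6 : σ x = 1 := h4.self_of_nhds
    refine ⟨by simp [h6], ?_⟩
    have e : weakGrad Ω (fun x => σ x * (1 - ψ x)) x = - weakGrad Ω ψ x := by
      ext k
      simp [weakGrad, h2' k, h5, h6]
    rw [e, quad_neg]

/-- Dominated convergence with majorant φ². The bounds 0 ≤ ψ ≤ 1 are what permit an arbitrary φ in
L₂. -/
lemma tendsto_eLpNorm_mul_of_ae_tendsto {α : Type*} {m : MeasurableSpace α} {μ : Measure α}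
    {ψ : ℕ → α → ℝ} {φ : α → ℝ} (hψm : ∀ n, AEStronglyMeasurable (ψ n) μ)
    (hψ1 : ∀ n, ∀ᵐ x ∂μ, 0 ≤ ψ n x ∧ ψ n x ≤ 1)
    (hψ : ∀ᵐ x ∂μ, Tendsto (fun n => ψ n x) atTop (𝓝 0)) (hφ : MemLp φ 2 μ) :
    Tendsto (fun n => eLpNorm (fun x => ψ n x * φ x) 2 μ) atTop (𝓝 0) := by
  refine tendsto_zero_of_tendsto_sq ?_
  simp only [eLpNorm_two_sq]
  have h := tendsto_lintegral_of_dominated_convergence' (μ := μ)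
    (F := fun n x => ENNReal.ofReal ((ψ n x * φ x) ^ 2)) (f := fun _ => 0)
    (fun x => ENNReal.ofReal (φ x ^ 2))
    (fun n => (((hψm n).mul hφ.1).pow 2).aemeasurable.ennreal_ofReal)
    (fun n => (hψ1 n).mono fun x hx => ?_) ?_ (hψ.mono fun x hx => ?_)
  · simpa using h
  · refine ENNReal.ofReal_le_ofReal ?_
    rw [mul_pow]
    exact mul_le_of_le_one_left (sq_nonneg _) (pow_le_one₀ hx.1 hx.2)
  · rw [← eLpNorm_two_sq]
    exact ENNReal.pow_ne_top hφ.eLpNorm_ne_top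
  · have h1 : Tendsto (fun n => (ψ n x * φ x) ^ 2) atTop (𝓝 ((0 * φ x) ^ 2)) :=
      (hx.mul_const _).pow 2
    simpa using ENNReal.tendsto_ofReal h1

theorem conditionC_of_capacity_frontier_eq_zero (hΩ : IsOpen Ω) (hpos : ∀ x ∈ Ω, (c x).PosDef)
    (hcont : ∀ k l, ContinuousOn (fun x => c x k l) Ω) (hcap : capacity Ω c (frontier Ω) = 0)
    {A : Set (Rd d)} (hA : Bornology.IsBounded A) : ConditionC Ω c A := by
  have hex : ∀ n : ℕ, ∃ ψ : Rd d → ℝ, MemFormN Ω c ψ ∧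
      (∀ᵐ x ∂(volume.restrict Ω), 0 ≤ ψ x ∧ ψ x ≤ 1) ∧
      (∃ U : Set (Rd d), IsOpen U ∧ frontier Ω ⊆ U ∧
        ∀ᵐ x ∂(volume.restrict (U ∩ Ω)), ψ x = 1) ∧
      ENNReal.ofReal (graphNormSq Ω c ψ) < (n + 1 : ℝ≥0∞)⁻¹ := fun n => by
    have h : capacity Ω c (frontier Ω) < (n + 1 : ℝ≥0∞)⁻¹ := by
      rw [hcap]
      exact pos_iff_ne_zero.2 (by simp)
    simp only [capacity, iInf_lt_iff] at h
    obtain ⟨ψ, h1, h2, h3, h4⟩ := h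
    exact ⟨ψ, h1, h2, h3, h4⟩
  choose ψ hN h01 hU hnorm using hex
  have hlim : Tendsto (fun n : ℕ => (n + 1 : ℝ≥0∞)⁻¹) atTop (𝓝 0) := by
    have h := (tendsto_add_atTop_iff_nat 1).2 ENNReal.tendsto_inv_nat_nhds_zero
    simpa using h
  have hψm : ∀ n, AEStronglyMeasurable (ψ n) (volume.restrict Ω) := fun n =>
    ((hN n).1.1.locallyIntegrableOn hΩ).aestronglyMeasurable
  have hgr : Tendsto (fun n => ∫⁻ x in Ω, ENNReal.ofReal (quad c x (weakGrad Ω (ψ n) x)))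
      atTop (𝓝 0) :=
    tendsto_of_tendsto_of_tendsto_of_le_of_le tendsto_const_nhds hlim (fun n => zero_le)
      fun n => ((hN n).lintegral_le hΩ hpos hcont).1.trans (hnorm n).le
  have hL2 : Tendsto (fun n => eLpNorm (ψ n) 2 (volume.restrict Ω)) atTop (𝓝 0) :=
    tendsto_zero_of_tendsto_sq <|
    tendsto_of_tendsto_of_tendsto_of_le_of_le tendsto_const_nhds hlim (fun n => zero_le)
      fun n => ((hN n).lintegral_le hΩ hpos hcont).2.trans (hnorm n).le
  -- L₂ convergence of `ψ n` does not control `ψ n * φ` for unbounded φ; almost everywhere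
  -- convergence along a subsequence does.
  have hmeas : TendstoInMeasure (volume.restrict Ω) ψ atTop (fun _ => 0) :=
    tendstoInMeasure_of_tendsto_eLpNorm (p := 2) (by simp) hψm aestronglyMeasurable_const
      (by simpa [Pi.sub_def] using hL2)
  obtain ⟨s, hs, hae⟩ := hmeas.exists_seq_tendsto_ae
  choose U hUo hfU hψU using hU
  have hη := fun n => exists_memFormD_of_eq_one_near_frontier hΩ hpos hcont hA (hUo n) (hfU n)
    (hN n).1 (hψU n)
  choose η hηD hη using hη
  have hm : MeasurableSet (closure A ∩ Ω) := isClosed_closure.measurableSet.inter hΩ.measurableSet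
  -- `A` need not be measurable, so the estimates are made on `closure A ∩ Ω`.
  have hAm : volume.restrict (A ∩ Ω) ≤ volume.restrict (closure A ∩ Ω) :=
    Measure.restrict_mono (inter_subset_inter_left _ subset_closure) le_rfl
  have hΩm : volume.restrict (closure A ∩ Ω) ≤ volume.restrict Ω :=
    Measure.restrict_mono inter_subset_right le_rfl
  refine ⟨fun i => η (s i), fun i => hηD _, fun φ hφ => ?_, ?_⟩
  · refine tendsto_of_tendsto_of_tendsto_of_le_of_le tendsto_const_nhds
      (tendsto_eLpNorm_mul_of_ae_tendsto (fun i => hψm (s i)) (fun i => h01 (s i)) hae hφ)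
      (fun i => zero_le) fun i => ?_
    refine (eLpNorm_mono_measure _ hAm).trans ?_
    rw [eLpNorm_congr_ae (g := fun x => ψ (s i) x * φ x)
      ((hη (s i)).mono fun x hx => by simp only [hx.1])]
    exact eLpNorm_mono_measure _ hΩm
  · refine tendsto_of_tendsto_of_tendsto_of_le_of_le tendsto_const_nhds
      (hgr.comp hs.tendsto_atTop) (fun i => zero_le) fun i => ?_
    refine (eLpNorm_mono_measure _ hAm).trans ?_
    rw [eLpNorm_one_eq_lintegral_enorm]
    refine (lintegral_mono_ae ?_).trans (lintegral_mono_set inter_subset_right)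
    filter_upwards [hη (s i), ae_restrict_mem hm] with x hx hxm
    rw [carreDuChamp_eq_quad, Real.enorm_eq_ofReal (quad_nonneg hpos hxm.2 _)]
    exact ENNReal.ofReal_le_ofReal hx.2

end form

/-! ### The condition `𝒞_A` implies zero capacity of the boundary -/

section form

variable {Ω : Set (Rd d)} {c : Rd d → Matrix (Fin d) (Fin d) ℝ}

/-- The density of the form norm of a smooth function. -/
def energyDensity (c : Rd d → Matrix (Fin d) (Fin d) ℝ) (f : Rd d → ℝ) (x : Rd d) : ℝ :=
  quad c x (grad f x) + f x ^ 2

/-- The form norm of a smooth function. -/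
def energy (Ω : Set (Rd d)) (c : Rd d → Matrix (Fin d) (Fin d) ℝ) (f : Rd d → ℝ) : ℝ≥0∞ :=
  ∫⁻ x in Ω, ENNReal.ofReal (energyDensity c f x)

lemma energyDensity_nonneg (hpos : ∀ x ∈ Ω, (c x).PosDef) {x : Rd d} (hx : x ∈ Ω) (f : Rd d → ℝ) :
    0 ≤ energyDensity c f x :=
  add_nonneg (quad_nonneg hpos hx _) (sq_nonneg _)

lemma aestronglyMeasurable_energyDensity (hΩ : IsOpen Ω)
    (hcont : ∀ k l, ContinuousOn (fun x => c x k l) Ω) {f : Rd d → ℝ} (hf : ContDiff ℝ ∞ f) :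
    AEStronglyMeasurable (energyDensity c f) (volume.restrict Ω) :=
  (aestronglyMeasurable_quad hΩ hcont fun k => aestronglyMeasurable_grad hf k _).add
    (hf.continuous.pow 2).aestronglyMeasurable

lemma grad_mul {f g : Rd d → ℝ} (hf : Differentiable ℝ f) (hg : Differentiable ℝ g) (x : Rd d) :
    grad (fun y => f y * g y) x = f x • grad g x + g x • grad f x :=
  funext fun k => partialDeriv_mul (hf x) (hg x) k

/-- Pointwise estimate for `ρ (1 - χ)` in terms of an approximation `η` of `χ` with gradient `w`. -/
lemma energyDensity_mul_one_sub_le (hpos : ∀ x ∈ Ω, (c x).PosDef) {ρ χ : Rd d → ℝ}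
    (hρ : Differentiable ℝ ρ) (hχ : Differentiable ℝ χ) {M : ℝ} {x : Rd d} (hx : x ∈ Ω)
    (hM1 : quad c x (grad ρ x) ≤ M) (hM2 : ρ x ^ 2 ≤ M) (w : Fin d → ℝ) (a : ℝ) :
    energyDensity c (fun y => ρ y * (1 - χ y)) x ≤
      6 * M * (quad c x (grad χ x - w) + quad c x w + (1 - a) ^ 2 + (χ x - a) ^ 2) := by
  have hM0 : 0 ≤ M := (sq_nonneg _).trans hM2
  have hg1 : grad (fun y => 1 - χ y) x = - grad χ x :=
    funext fun k => partialDeriv_one_sub χ x k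
  have e : grad (fun y => ρ y * (1 - χ y)) x = (-ρ x) • grad χ x + (1 - χ x) • grad ρ x := by
    rw [grad_mul hρ (hχ.const_sub 1), hg1, smul_neg, neg_smul]
  -- Each gradient term acquires 2·2 = 4. The factor (1 - χ)² occurs with weight 2 from the gradient
  -- and 1 from the square, and splitting it doubles this to 6, the larger constant.
  have h1 := quad_add_le hpos hx ((-ρ x) • grad χ x) ((1 - χ x) • grad ρ x)
  rw [← e, quad_smul, quad_smul, neg_sq] at h1
  have h2 := quad_add_le hpos hx (grad χ x - w) w
  rw [sub_add_cancel] at h2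
  have h3 : (1 - χ x) ^ 2 ≤ 2 * (1 - a) ^ 2 + 2 * (χ x - a) ^ 2 := by
    nlinarith [sq_nonneg ((1 - a) + (χ x - a))]
  have q1 := quad_nonneg hpos hx (grad χ x - w)
  have q2 := quad_nonneg hpos hx w
  have q3 := quad_nonneg hpos hx (grad χ x)
  have h4 : ρ x ^ 2 * quad c x (grad χ x) ≤ M * quad c x (grad χ x) := by gcongr
  have h5 : (1 - χ x) ^ 2 * quad c x (grad ρ x) ≤ (1 - χ x) ^ 2 * M := by gcongr
  have h6 : ρ x ^ 2 * (1 - χ x) ^ 2 ≤ M * (1 - χ x) ^ 2 := by gcongr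
  have h7 := mul_le_mul_of_nonneg_left h2 hM0
  have h8 := mul_le_mul_of_nonneg_left h3 hM0
  have h9 := mul_nonneg hM0 q1
  have h10 := mul_nonneg hM0 q2
  simp only [energyDensity, mul_pow]
  nlinarith

/-- Under `𝒞_A` for bounded sets, any cutoff function can be corrected by a test function on `Ω` to
have small form norm. -/
lemma exists_energy_mul_one_sub_le (hΩ : IsOpen Ω) (hpos : ∀ x ∈ Ω, (c x).PosDef)
    (hF : ∀ k l, ∃ F : Rd d → ℝ, Continuous F ∧ EqOn (fun x => c x k l) F Ω)
    (hC : ∀ A : Set (Rd d), A ⊆ closure Ω → Bornology.IsBounded A → ConditionC Ω c A)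
    {ρ : Rd d → ℝ} (hρ : ContDiff ℝ ∞ ρ) (hρs : HasCompactSupport ρ) {ε : ℝ≥0∞} (hε : ε ≠ 0) :
    ∃ χ : Rd d → ℝ, IsTestFunction Ω χ ∧ energy Ω c (fun y => ρ y * (1 - χ y)) ≤ ε := by
  have hcont : ∀ k l, ContinuousOn (fun x => c x k l) Ω := fun k l => by
    obtain ⟨F, h1, h2⟩ := hF k l
    exact h1.continuousOn.congr h2
  set K := tsupport ρ with hKdef
  have hK : IsCompact K := hρs
  obtain ⟨M, hM0, hM1, hM2⟩ : ∃ M : ℝ, 0 ≤ M ∧ (∀ x ∈ K ∩ Ω, quad c x (grad ρ x) ≤ M) ∧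
      ∀ x ∈ K, ρ x ^ 2 ≤ M := by
    -- `K ∩ Ω` may reach the boundary and need not be compact; the continuous extensions bound the
    -- coefficients on all of it.
    choose F hFc hFe using hF
    have hq : Continuous fun x => ∑ k, ∑ l, F k l x * grad ρ x k * grad ρ x l := by
      have := fun k => continuous_partialDeriv hρ k
      unfold grad
      fun_prop
    obtain ⟨M1, h1⟩ := hK.exists_bound_of_continuousOn hq.continuousOn
    obtain ⟨M2, h2⟩ := hK.exists_bound_of_continuousOn (hρ.continuous.pow 2).continuousOn
    refine ⟨max 0 (max M1 M2), le_max_left _ _, fun x hx => ?_, fun x hx => ?_⟩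
    · refine ((le_abs_self _).trans ?_).trans ((le_max_left M1 M2).trans (le_max_right _ _))
      have e : quad c x (grad ρ x) = ∑ k, ∑ l, F k l x * grad ρ x k * grad ρ x l :=
        Finset.sum_congr rfl fun k _ => Finset.sum_congr rfl fun l _ => by rw [← hFe k l hx.2]
      rw [e, ← Real.norm_eq_abs]
      exact h1 x hx.1
    · exact ((le_abs_self _).trans (h2 x hx)).trans
        ((le_max_right M1 M2).trans (le_max_right _ _))
  obtain ⟨δ, hδ0, hδ⟩ : ∃ δ : ℝ≥0∞, δ ≠ 0 ∧ ENNReal.ofReal (6 * M) * (δ + δ + δ + δ) ≤ ε := by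
    have ht : Tendsto (fun δ : ℝ≥0∞ => ENNReal.ofReal (6 * M) * (δ + δ + δ + δ)) (𝓝[>] 0)
        (𝓝 0) := by
      have h1 : Tendsto (fun δ : ℝ≥0∞ => δ + δ + δ + δ) (𝓝[>] 0) (𝓝 0) := by
        have h0 : Continuous fun δ : ℝ≥0∞ => δ + δ + δ + δ := by fun_prop
        simpa using (h0.tendsto 0).mono_left nhdsWithin_le_nhds
      simpa using ENNReal.Tendsto.const_mul (a := ENNReal.ofReal (6 * M)) h1
        (Or.inr ENNReal.ofReal_ne_top)
    obtain ⟨δ, h1, h2⟩ := ((ht.eventually (ge_mem_nhds (pos_iff_ne_zero.2 hε))).and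
      self_mem_nhdsWithin).exists
    exact ⟨δ, (pos_iff_ne_zero.1 h2), h1⟩
  have hδp : 0 < δ := pos_iff_ne_zero.2 hδ0
  obtain ⟨η, hηD, hη1, hη2⟩ := hC (K ∩ closure Ω) inter_subset_right
    (hK.isBounded.subset inter_subset_left)
  have hset : K ∩ closure Ω ∩ Ω = K ∩ Ω := by
    rw [inter_assoc, inter_eq_self_of_subset_right subset_closure]
  rw [hset] at hη1 hη2
  have hKm : MeasurableSet K := hK.measurableSet
  have hm : MeasurableSet (K ∩ Ω) := hKm.inter hΩ.measurableSet
  -- The indicator of `K`, in L₂ because `K` has finite volume, turns the strong convergence in 𝒞_A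
  -- into L₂ convergence of `1 - η n` to 0 on `K ∩ Ω`.
  have hφ : MemLp (K.indicator fun _ => (1 : ℝ)) 2 (volume.restrict Ω) :=
    memLp_indicator_const 2 hKm 1
      (Or.inr ((Measure.restrict_le_self K).trans_lt hK.measure_lt_top).ne)
  have hη1' : Tendsto (fun n => ∫⁻ x in K ∩ Ω, ENNReal.ofReal ((1 - η n x) ^ 2)) atTop (𝓝 0) := by
    have h1 := (ENNReal.continuous_pow 2).continuousAt.tendsto.comp (hη1 _ hφ)
    simp only [Function.comp_def, eLpNorm_two_sq, zero_pow two_ne_zero] at h1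
    refine h1.congr fun n => setLIntegral_congr_fun hm fun x hx => ?_
    simp [hx.1]
  have hη2' : Tendsto (fun n => ∫⁻ x in K ∩ Ω, ENNReal.ofReal (quad c x (weakGrad Ω (η n) x)))
      atTop (𝓝 0) := by
    simp only [eLpNorm_one_eq_lintegral_enorm] at hη2
    refine hη2.congr fun n => setLIntegral_congr_fun hm fun x hx => ?_
    exact Real.enorm_eq_ofReal (quad_nonneg hpos hx.2 _)
  obtain ⟨n, hn1, hn2⟩ := ((hη1'.eventually (ge_mem_nhds hδp)).and
    (hη2'.eventually (ge_mem_nhds hδp))).exists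
  obtain ⟨χ, hχ, hχ1, hχ2⟩ := (hηD n).exists_approx hΩ hpos hcont
  have hχ1' : Tendsto (fun m => ∫⁻ x in Ω, ENNReal.ofReal ((χ m x - η n x) ^ 2))
      atTop (𝓝 0) := by
    have h1 := (ENNReal.continuous_pow 2).continuousAt.tendsto.comp hχ1
    simpa only [Function.comp_def, eLpNorm_two_sq, zero_pow two_ne_zero, Pi.sub_apply] using h1
  obtain ⟨m, hm1, hm2⟩ := ((hχ1'.eventually (ge_mem_nhds hδp)).and
    (hχ2.eventually (ge_mem_nhds hδp))).exists
  refine ⟨χ m, hχ m, le_trans ?_ hδ⟩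
  set f : Rd d → ℝ := fun y => ρ y * (1 - χ m y)
  have hzero : ∀ x ∉ K, energyDensity c f x = 0 := fun x hx => by
    have hf : f =ᶠ[𝓝 x] fun _ => 0 := by
      filter_upwards [(notMem_tsupport_iff_eventuallyEq.1 hx)] with y hy
      simp [f, hy]
    have hg : grad f x = 0 := funext fun k => by
      simp only [grad]
      rw [partialDeriv_congr hf]
      simp [partialDeriv]
    simp [energyDensity, hg, quad, hf.self_of_nhds]
  set w := weakGrad Ω (η n)
  have hle : ∀ x ∈ Ω, ENNReal.ofReal (energyDensity c f x) ≤ (K ∩ Ω).indicator (fun x =>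
      ENNReal.ofReal (6 * M) * (ENNReal.ofReal (quad c x (grad (χ m) x - w x)) +
        ENNReal.ofReal (quad c x (w x)) + ENNReal.ofReal ((1 - η n x) ^ 2) +
        ENNReal.ofReal ((χ m x - η n x) ^ 2))) x := fun x hx => by
    by_cases hxK : x ∈ K
    · have q1 := quad_nonneg hpos hx (grad (χ m) x - w x)
      have q2 := quad_nonneg hpos hx (w x)
      have hxm : x ∈ K ∩ Ω := ⟨hxK, hx⟩
      rw [indicator_of_mem hxm, ← ENNReal.ofReal_add q1 q2,
        ← ENNReal.ofReal_add (by positivity) (by positivity),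
        ← ENNReal.ofReal_add (by positivity) (by positivity),
        ← ENNReal.ofReal_mul (by positivity)]
      exact ENNReal.ofReal_le_ofReal (energyDensity_mul_one_sub_le hpos
        (hρ.differentiable (by simp)) (hχ m).differentiable hx (hM1 x ⟨hxK, hx⟩) (hM2 x hxK)
        (w x) (η n x))
    · simp [hzero x hxK]
  have hmono : volume.restrict (K ∩ Ω) ≤ volume.restrict Ω :=
    Measure.restrict_mono inter_subset_right le_rfl
  have hwm : ∀ k, AEStronglyMeasurable (fun x => w x k) (volume.restrict Ω) := fun k =>
    aestronglyMeasurable_weakPartial Ω k (η n)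
  have m1 : AEMeasurable (fun x => ENNReal.ofReal (quad c x (grad (χ m) x - w x)))
      (volume.restrict (K ∩ Ω)) :=
    ((aestronglyMeasurable_quad hΩ hcont fun k => (aestronglyMeasurable_grad (hχ m).1 k _).sub
      (hwm k)).mono_measure hmono).aemeasurable.ennreal_ofReal
  have m2 : AEMeasurable (fun x => ENNReal.ofReal (quad c x (w x)))
      (volume.restrict (K ∩ Ω)) :=
    ((aestronglyMeasurable_quad hΩ hcont hwm).mono_measure hmono).aemeasurable.ennreal_ofReal
  have hηm : AEStronglyMeasurable (η n) (volume.restrict (K ∩ Ω)) :=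
    (hηD n).1.1.mono_measure hmono
  have m3 : AEMeasurable (fun x => ENNReal.ofReal ((1 - η n x) ^ 2)) (volume.restrict (K ∩ Ω)) :=
    ((aestronglyMeasurable_const.sub hηm).pow 2).aemeasurable.ennreal_ofReal
  have m12 : AEMeasurable (fun x => ENNReal.ofReal (quad c x (grad (χ m) x - w x)) +
      ENNReal.ofReal (quad c x (w x))) (volume.restrict (K ∩ Ω)) := m1.add m2
  have m123 : AEMeasurable (fun x => ENNReal.ofReal (quad c x (grad (χ m) x - w x)) +
      ENNReal.ofReal (quad c x (w x)) + ENNReal.ofReal ((1 - η n x) ^ 2))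
      (volume.restrict (K ∩ Ω)) := m12.add m3
  calc energy Ω c f ≤ _ := setLIntegral_mono' hΩ.measurableSet hle
    _ ≤ ∫⁻ x in K ∩ Ω, ENNReal.ofReal (6 * M) *
        (ENNReal.ofReal (quad c x (grad (χ m) x - w x)) +
        ENNReal.ofReal (quad c x (w x)) + ENNReal.ofReal ((1 - η n x) ^ 2) +
        ENNReal.ofReal ((χ m x - η n x) ^ 2)) :=
      (setLIntegral_le_lintegral _ _).trans_eq (lintegral_indicator hm _)
    _ = ENNReal.ofReal (6 * M) * ((∫⁻ x in K ∩ Ω,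
          ENNReal.ofReal (quad c x (grad (χ m) x - w x))) +
        (∫⁻ x in K ∩ Ω, ENNReal.ofReal (quad c x (w x))) +
        (∫⁻ x in K ∩ Ω, ENNReal.ofReal ((1 - η n x) ^ 2)) +
        ∫⁻ x in K ∩ Ω, ENNReal.ofReal ((χ m x - η n x) ^ 2)) := by
      rw [lintegral_const_mul' _ _ ENNReal.ofReal_ne_top, lintegral_add_left' m123,
        lintegral_add_left' m12, lintegral_add_left' m1]
    _ ≤ ENNReal.ofReal (6 * M) * (δ + δ + δ + δ) := by
      gcongr
      · exact (lintegral_mono_set inter_subset_right).trans hm2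
      · exact (lintegral_mono_set inter_subset_right).trans hm1

/-- Smooth functions of finite energy which are one near the boundary bound the capacity. -/
lemma capacity_frontier_le (hΩ : IsOpen Ω) (hpos : ∀ x ∈ Ω, (c x).PosDef)
    (hcont : ∀ k l, ContinuousOn (fun x => c x k l) Ω) {u : Rd d → ℝ} (hu : ContDiff ℝ ∞ u)
    (hu01 : ∀ x, 0 ≤ u x ∧ u x ≤ 1) (hu1 : ∀ x ∈ frontier Ω, ∀ᶠ y in 𝓝 x, u y = 1)
    (hE : energy Ω c u ≠ ⊤) : capacity Ω c (frontier Ω) ≤ energy Ω c u := by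
  have hw : ∀ᵐ x ∂(volume.restrict Ω), weakGrad Ω u x = grad u x := by
    filter_upwards [ae_all_iff.2 fun k =>
      (HasWeakPartial.of_contDiff (Ω := Ω) hu k).weakPartial_ae_eq hΩ] with x hx
    exact funext hx
  have hn : ∀ᵐ x ∂(volume.restrict Ω), 0 ≤ quad c x (grad u x) :=
    (ae_restrict_mem hΩ.measurableSet).mono fun x hx => quad_nonneg hpos hx _
  have hn' : ∀ᵐ x ∂(volume.restrict Ω), 0 ≤ energyDensity c u x :=
    hn.mono fun x hx => add_nonneg hx (sq_nonneg _)
  have hmE := aestronglyMeasurable_energyDensity hΩ hcont hu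
  have hi : IntegrableOn (energyDensity c u) Ω :=
    (lintegral_ofReal_ne_top_iff_integrable hmE hn').1 hE
  have hi1 : IntegrableOn (fun x => quad c x (grad u x)) Ω := by
    refine Integrable.mono' hi (aestronglyMeasurable_quad hΩ hcont fun k =>
      aestronglyMeasurable_grad hu k _) (hn.mono fun x hx => ?_)
    rw [Real.norm_of_nonneg hx]
    exact le_add_of_nonneg_right (sq_nonneg _)
  have hi2 : IntegrableOn (fun x => u x ^ 2) Ω := by
    refine Integrable.mono' hi (hu.continuous.pow 2).aestronglyMeasurable (hn.mono fun x hx => ?_)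
    rw [Real.norm_of_nonneg (sq_nonneg _)]
    exact le_add_of_nonneg_left hx
  have hN : MemFormN Ω c u := by
    have hloc : ∀ f : Rd d → ℝ, Continuous f → MemLpLoc 2 Ω f := fun f hf K hK _ => by
      have h1 : MemLp f ⊤ (volume.restrict K) := by
        obtain ⟨C, hC⟩ := hK.exists_bound_of_continuousOn hf.continuousOn
        exact memLp_top_of_bound hf.aestronglyMeasurable C
          ((ae_restrict_mem hK.measurableSet).mono hC)
      have : IsFiniteMeasure (volume.restrict K) :=
        isFiniteMeasure_restrict.2 hK.measure_lt_top.ne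
      exact h1.mono_exponent le_top
    refine ⟨⟨hloc u hu.continuous, fun k => ⟨_, HasWeakPartial.of_contDiff hu k,
      hloc _ (continuous_partialDeriv hu k)⟩⟩, ?_⟩
    refine hi.congr (hw.mono fun x hx => ?_)
    simp only [energyDensity, carreDuChamp_eq_quad, hx]
  have hnorm : ENNReal.ofReal (graphNormSq Ω c u) = energy Ω c u := by
    have e : formN Ω c u = ∫ x in Ω, quad c x (grad u x) :=
      integral_congr_ae (hw.mono fun x hx => by simp only [carreDuChamp_eq_quad, hx])
    rw [graphNormSq, e, ← integral_add hi1 hi2]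
    exact ofReal_integral_eq_lintegral_ofReal hi hn'
  rw [← hnorm]
  refine iInf_le_of_le u (iInf_le_of_le hN (iInf_le_of_le (Eventually.of_forall hu01)
    (iInf_le_of_le ⟨interior {y | u y = 1}, isOpen_interior, fun x hx => ?_, ?_⟩ le_rfl)))
  · exact mem_interior_iff_mem_nhds.2 (hu1 x hx)
  · refine (ae_restrict_mem (isOpen_interior.inter hΩ).measurableSet).mono fun x hx => ?_
    exact interior_subset (s := {y | u y = 1}) hx.1

/-! ### Truncation and infinite sums of smooth functions -/

/-- A smooth truncation. -/
lemma exists_abs_smoothTransition_le : ∃ L : ℝ, 0 ≤ L ∧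
    (∀ t, |deriv Real.smoothTransition t| ≤ L) ∧ ∀ t, |Real.smoothTransition t| ≤ L * |t| := by
  have hT : ContDiff ℝ ∞ Real.smoothTransition := Real.smoothTransition.contDiff
  obtain ⟨L, hL⟩ := (isCompact_Icc (a := (0 : ℝ)) (b := 1)).exists_bound_of_continuousOn
    (hT.continuous_deriv (by simp)).continuousOn
  have hL0 : 0 ≤ L := (norm_nonneg _).trans (hL 0 (by simp))
  -- The transition function is constant outside [0,1], so the bound on that interval is global. As
  -- it vanishes at 0, the mean value inequality gives the linear bound.
  have hd : ∀ t, ‖deriv Real.smoothTransition t‖ ≤ L := fun t => by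
    rcases lt_or_ge t 0 with h | h
    · have e : Real.smoothTransition =ᶠ[𝓝 t] fun _ => 0 := by
        filter_upwards [gt_mem_nhds h] with y hy
        exact Real.smoothTransition.zero_of_nonpos hy.le
      rw [e.deriv_eq]
      simpa using hL0
    · rcases lt_or_ge 1 t with h' | h'
      · have e : Real.smoothTransition =ᶠ[𝓝 t] fun _ => 1 := by
          filter_upwards [lt_mem_nhds h'] with y hy
          exact Real.smoothTransition.one_of_one_le hy.le
        rw [e.deriv_eq]
        simpa using hL0
      · exact hL t ⟨h, h'⟩
  refine ⟨L, hL0, hd, fun t => ?_⟩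
  have h := convex_univ.norm_image_sub_le_of_norm_deriv_le
    (fun x _ => hT.differentiable (by simp) x) (fun x _ => hd x) (mem_univ (0 : ℝ)) (mem_univ t)
  simpa using h

/-- Splitting off the first term puts a factor 2 on it and doubles every later weight. The resulting
weights do not depend on `J`, so the estimate survives for infinite sums. -/
lemma sum_le_of_add_le {V : Type*} [AddCommMonoid V] {q : V → ℝ} (h0 : q 0 = 0)
    (hq : ∀ a b, q (a + b) ≤ 2 * q a + 2 * q b) (J : ℕ) (v : ℕ → V) :
    q (∑ j ∈ Finset.range J, v j) ≤ ∑ j ∈ Finset.range J, 2 ^ (j + 1) * q (v j) := by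
  induction J generalizing v with
  | zero => simp [h0]
  | succ J ih =>
    rw [Finset.sum_range_succ', Finset.sum_range_succ']
    have h1 := hq (∑ j ∈ Finset.range J, v (j + 1)) (v 0)
    have h2 := ih fun j => v (j + 1)
    have h3 : ∑ j ∈ Finset.range J, (2 : ℝ) ^ (j + 1 + 1) * q (v (j + 1))
        = 2 * ∑ j ∈ Finset.range J, 2 ^ (j + 1) * q (v (j + 1)) := by
      rw [Finset.mul_sum]
      exact Finset.sum_congr rfl fun j _ => by ring
    rw [h3]
    simp only [zero_add, pow_one]
    linarith

lemma energyDensity_congr {f g : Rd d → ℝ} {x : Rd d} (h : f =ᶠ[𝓝 x] g) :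
    energyDensity c f x = energyDensity c g x := by
  have e : grad f x = grad g x := funext fun k => partialDeriv_congr h k
  rw [energyDensity, energyDensity, e, h.self_of_nhds]

lemma energyDensity_sum_le (hpos : ∀ x ∈ Ω, (c x).PosDef) {x : Rd d} (hx : x ∈ Ω)
    {f : ℕ → Rd d → ℝ} (hf : ∀ j, ContDiff ℝ ∞ (f j)) (J : ℕ) :
    energyDensity c (fun y => ∑ j ∈ Finset.range J, f j y) x
      ≤ ∑ j ∈ Finset.range J, 2 ^ (j + 1) * energyDensity c (f j) x := by
  have e : grad (fun y => ∑ j ∈ Finset.range J, f j y) x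
      = ∑ j ∈ Finset.range J, grad (f j) x := by
    ext k
    rw [Finset.sum_apply]
    exact partialDeriv_finset_sum _ hf k x
  have h1 := sum_le_of_add_le (q := quad c x) (by simp [quad]) (quad_add_le hpos hx) J
    fun j => grad (f j) x
  have h2 := sum_le_of_add_le (q := fun t : ℝ => t ^ 2) (by simp)
    (fun a b => by nlinarith [sq_nonneg (a - b)]) J fun j => f j x
  simp only [energyDensity, mul_add, Finset.sum_add_distrib, e]
  exact add_le_add h1 h2

theorem capacity_frontier_eq_zero_of_conditionC (hΩ : IsOpen Ω) (hpos : ∀ x ∈ Ω, (c x).PosDef)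
    (hF : ∀ k l, ∃ F : Rd d → ℝ, Continuous F ∧ EqOn (fun x => c x k l) F Ω)
    (hC : ∀ A : Set (Rd d), A ⊆ closure Ω → Bornology.IsBounded A → ConditionC Ω c A) :
    capacity Ω c (frontier Ω) = 0 := by
  have hcont : ∀ k l, ContinuousOn (fun x => c x k l) Ω := fun k l => by
    obtain ⟨F, h1, h2⟩ := hF k l
    exact h1.continuousOn.congr h2
  obtain ⟨L, hL0, hL1, hL2⟩ := exists_abs_smoothTransition_le
  -- a locally finite smooth partition of unity
  let b : ℕ → ContDiffBump (0 : Rd d) := fun j =>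
    ⟨j + 1, j + 2, by positivity, by linarith⟩
  let ρ : ℕ → Rd d → ℝ := fun j => match j with
    | 0 => b 0
    | j + 1 => b (j + 1) - b j
  have hρ : ∀ j, ContDiff ℝ ∞ (ρ j) := fun j => match j with
    | 0 => (b 0).contDiff
    | j + 1 => (b (j + 1)).contDiff.sub (b j).contDiff
  have hρs : ∀ j, HasCompactSupport (ρ j) := fun j => match j with
    | 0 => (b 0).hasCompactSupport
    | j + 1 => (b (j + 1)).hasCompactSupport.sub (b j).hasCompactSupport
  have hb1 : ∀ (j : ℕ) (x : Rd d), ‖x‖ < j + 1 → b j x = 1 := fun j x hx =>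
    (b j).one_of_mem_closedBall (mem_closedBall_zero_iff.2 hx.le)
  -- For j ≥ 1, `ρ j` is a difference of two bumps, both 1 on the ball of radius `j`; `J = 0` is
  -- vacuous. This is the local finiteness, and the telescoping below gives total sum 1.
  have hρ0 : ∀ (J j : ℕ) (x : Rd d), ‖x‖ < J → J ≤ j → ρ j x = 0 := fun J j x hx hj => by
    rcases j with _ | j
    · obtain rfl : J = 0 := by omega
      exact absurd hx (by simp)
    · have h1 : (J : ℝ) ≤ j + 1 := by exact_mod_cast hj
      change b (j + 1) x - b j x = 0
      rw [hb1 j x (hx.trans_le h1), hb1 (j + 1) x (by push_cast; linarith), sub_self]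
  have hρsum : ∀ (J : ℕ) (x : Rd d), ∑ j ∈ Finset.range (J + 1), ρ j x = b J x := fun J x => by
    induction J with
    | zero => simp [ρ]
    | succ J ih =>
      rw [Finset.sum_range_succ, ih]
      simp [ρ]
  have key : ∀ ε : ℝ≥0∞, ε ≠ 0 → ε ≠ ⊤ →
      capacity Ω c (frontier Ω) ≤ ENNReal.ofReal (L ^ 2) * ε := fun ε hε hε' => by
    -- Division by `2 ^ (j + 1)` below cancels the weights of `energyDensity_sum_le`, leaving the
    -- summable `e j`.
    obtain ⟨e, he0, hesum⟩ := ENNReal.exists_pos_sum_of_countable' hε ℕ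
    have hex : ∀ j : ℕ, ∃ χ : Rd d → ℝ, IsTestFunction Ω χ ∧
        energy Ω c (fun y => ρ j y * (1 - χ y)) ≤ e j / 2 ^ (j + 1) := fun j =>
      exists_energy_mul_one_sub_le hΩ hpos hF hC (hρ j) (hρs j)
        (ENNReal.div_ne_zero.2 ⟨(he0 j).ne', by simp⟩)
    choose χ hχ hχE using hex
    set f : ℕ → Rd d → ℝ := fun j y => ρ j y * (1 - χ j y) with hfdef
    have hf : ∀ j, ContDiff ℝ ∞ (f j) := fun j => (hρ j).mul (contDiff_const.sub (hχ j).1)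
    set ψ : Rd d → ℝ := fun x => ∑' j, f j x with hψdef
    have hnhds : ∀ x : Rd d, ∃ J : ℕ, ∀ᶠ y in 𝓝 x, ‖y‖ < J + 1 ∧
        ψ y = ∑ j ∈ Finset.range (J + 1), f j y := fun x => by
      obtain ⟨J, hJ⟩ := exists_nat_gt ‖x‖
      refine ⟨J, ?_⟩
      have hJ' : ‖x‖ < J + 1 := hJ.trans (lt_add_one _)
      filter_upwards [continuous_norm.continuousAt.eventually (gt_mem_nhds hJ')] with y hy
      refine ⟨hy, tsum_eq_sum fun j hj => ?_⟩
      have h1 := hρ0 (J + 1) j y (by push_cast; exact hy) (by simpa using hj)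
      simp [f, h1]
    have hψ : ContDiff ℝ ∞ ψ := by
      rw [contDiff_iff_contDiffAt]
      intro x
      obtain ⟨J, hJ⟩ := hnhds x
      have h1 : ContDiff ℝ ∞ fun y => ∑ j ∈ Finset.range (J + 1), f j y :=
        ContDiff.sum fun j _ => hf j
      exact h1.contDiffAt.congr_of_eventuallyEq (hJ.mono fun y hy => hy.2)
    have hψ1 : ∀ x ∈ frontier Ω, ∀ᶠ y in 𝓝 x, ψ y = 1 := fun x hx => by
      obtain ⟨J, hJ⟩ := hnhds x
      have hxΩ : x ∉ Ω := by
        rw [hΩ.frontier_eq] at hx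
        exact hx.2
      -- Only finitely many `j` matter near a boundary point, and each `χ j` vanishes near it since
      -- its closed support lies in Ω. There ψ reduces to the sum of the `ρ j`.
      have h1 : ∀ᶠ y in 𝓝 x, ∀ j ∈ Finset.range (J + 1), χ j y = 0 := by
        rw [Finset.eventually_all]
        intro j _
        exact notMem_tsupport_iff_eventuallyEq.1 fun h => hxΩ ((hχ j).2.2 h)
      filter_upwards [hJ, h1] with y hy hy1
      rw [hy.2, ← hb1 J y hy.1, ← hρsum]
      refine Finset.sum_congr rfl fun j hj => ?_
      simp [f, hy1 j hj]
    have hψE : energy Ω c ψ ≤ ε := by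
      have h1 : ∀ x ∈ Ω, ENNReal.ofReal (energyDensity c ψ x) ≤
          ∑' j : ℕ, 2 ^ (j + 1) * ENNReal.ofReal (energyDensity c (f j) x) := fun x hx => by
        obtain ⟨J, hJ⟩ := hnhds x
        rw [energyDensity_congr (hJ.mono fun y hy => hy.2)]
        refine (ENNReal.ofReal_le_ofReal (energyDensity_sum_le hpos hx hf (J + 1))).trans ?_
        rw [ENNReal.ofReal_sum_of_nonneg fun j _ =>
          mul_nonneg (by positivity) (energyDensity_nonneg hpos hx _)]
        refine le_trans (le_of_eq (Finset.sum_congr rfl fun j _ => ?_))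
          (ENNReal.sum_le_tsum (Finset.range (J + 1)))
        rw [ENNReal.ofReal_mul (by positivity), ENNReal.ofReal_pow (by norm_num)]
        simp
      have hmeas : ∀ j, AEMeasurable (fun x => ENNReal.ofReal (energyDensity c (f j) x))
          (volume.restrict Ω) := fun j =>
        (aestronglyMeasurable_energyDensity hΩ hcont (hf j)).aemeasurable.ennreal_ofReal
      calc energy Ω c ψ ≤ ∫⁻ x in Ω, ∑' j : ℕ,
            2 ^ (j + 1) * ENNReal.ofReal (energyDensity c (f j) x) :=
            setLIntegral_mono' hΩ.measurableSet h1
        _ = ∑' j : ℕ, 2 ^ (j + 1) * energy Ω c (f j) := by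
            rw [lintegral_tsum fun j => (hmeas j).const_mul _]
            exact tsum_congr fun j => lintegral_const_mul'' _ (hmeas j)
        _ ≤ ∑' j, e j := ENNReal.tsum_le_tsum fun j => by
            refine (mul_le_mul_right (hχE j) _).trans_eq ?_
            exact ENNReal.mul_div_cancel (by simp) (by simp)
        _ ≤ ε := hesum.le
    have hT : ContDiff ℝ ∞ Real.smoothTransition := Real.smoothTransition.contDiff
    -- ψ need not lie in [0,1]. Composition with the transition function enforces this, keeps the
    -- value 1, and multiplies the energy by at most `L ^ 2`, independently of ε.
    have huE : energy Ω c (fun x => Real.smoothTransition (ψ x)) ≤ ENNReal.ofReal (L ^ 2) * ε := by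
      refine le_trans ?_ (mul_le_mul_right hψE _)
      rw [energy, energy, ← lintegral_const_mul' _ _ ENNReal.ofReal_ne_top]
      refine setLIntegral_mono' hΩ.measurableSet fun x hx => ?_
      rw [← ENNReal.ofReal_mul (by positivity)]
      refine ENNReal.ofReal_le_ofReal ?_
      have eg : grad (fun y => Real.smoothTransition (ψ y)) x
          = deriv Real.smoothTransition (ψ x) • grad ψ x :=
        funext fun k => partialDeriv_comp hT hψ k x
      rw [energyDensity, energyDensity, eg, quad_smul, mul_add]
      refine add_le_add ?_ ?_
      · refine mul_le_mul_of_nonneg_right ?_ (quad_nonneg hpos hx _)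
        rw [← sq_abs]
        exact pow_le_pow_left₀ (abs_nonneg _) (hL1 _) 2
      · rw [← sq_abs, ← sq_abs (ψ x), ← mul_pow]
        exact pow_le_pow_left₀ (abs_nonneg _) (hL2 _) 2
    refine (capacity_frontier_le hΩ hpos hcont (hT.comp hψ)
      (fun x => ⟨Real.smoothTransition.nonneg _, Real.smoothTransition.le_one _⟩)
      (fun x hx => (hψ1 x hx).mono fun y hy => ?_) (huE.trans_lt ?_).ne).trans huE
    · simp only [Function.comp_apply, hy]
      exact Real.smoothTransition.one
    · exact ENNReal.mul_lt_top ENNReal.ofReal_lt_top hε'.lt_top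
  have hlim : Tendsto (fun n : ℕ => ENNReal.ofReal (L ^ 2) * (n + 1 : ℝ≥0∞)⁻¹) atTop (𝓝 0) := by
    have h := (tendsto_add_atTop_iff_nat 1).2 ENNReal.tendsto_inv_nat_nhds_zero
    simpa using ENNReal.Tendsto.const_mul (a := ENNReal.ofReal (L ^ 2)) h
      (Or.inr ENNReal.ofReal_ne_top)
  refine le_antisymm (ge_of_tendsto' hlim fun n => key _ (by simp) ?_) zero_le
  exact ENNReal.inv_ne_top.2 (by simp)

end form

end DiffusionCapacity

end

theorem corollary4p6 {d : ℕ} (Ω : Set (DiffusionCapacity.Rd d))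
    (hΩ_open : IsOpen Ω) (hΩ_conn : IsConnected Ω) (hΩ_zero : (0 : DiffusionCapacity.Rd d) ∈ Ω)
    (c : DiffusionCapacity.Rd d → Matrix (Fin d) (Fin d) ℝ)
    (hc_symm : ∀ x ∈ Ω, ∀ k l, c x k l = c x l k)
    (hc_pos : ∀ x ∈ Ω, (c x).PosDef)
    (hc_reg : ∀ k l, DiffusionCapacity.MemW1InftyLocClosure Ω (fun x => c x k l))
    (hball : ∀ r : ℝ, 0 < r → Bornology.IsBounded (DiffusionCapacity.riemannianBall Ω c r)) :
    (∀ A : Set (DiffusionCapacity.Rd d), A ⊆ closure Ω → Bornology.IsBounded A →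
        DiffusionCapacity.ConditionC Ω c A) ↔
      DiffusionCapacity.capacity Ω c (frontier Ω) = 0 := by
  have hF : ∀ k l, ∃ F : DiffusionCapacity.Rd d → ℝ,
      Continuous F ∧ EqOn (fun x => c x k l) F Ω := fun k l => by
    obtain ⟨F, h1, h2⟩ := hc_reg k l
    exact ⟨F, continuousOn_univ.1 h1.1, h2⟩
  have hcont : ∀ k l, ContinuousOn (fun x => c x k l) Ω := fun k l => by
    obtain ⟨F, h1, h2⟩ := hF k l
    exact h1.continuousOn.congr h2
  exact ⟨DiffusionCapacity.capacity_frontier_eq_zero_of_conditionC hΩ_open hc_pos hF,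
    fun h _ _ hA => DiffusionCapacity.conditionC_of_capacity_frontier_eq_zero hΩ_open hc_pos
      hcont h hA⟩
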